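/- Let $g,h,\rho>0$ and let $I\subset\mathbb R$ be an open set of times. Consider a classical solution $(\eta,\phi)$, for $t\in I$, of the one-dimensional free-surface water-wave problem on the whole line over a flat bottom, without surface tension: $\eta(t,x)>-h$; $$\phi_{xx}+\phi_{zz}=0\ \text{ for } -h<z<\eta,\qquad \phi_z=0\ \text{ on } z=-h,$$ $$\eta_t=\phi_z-\eta_x\phi_x,\qquad \phi_t+\tfrac12|\nabla\phi|^2+g\eta=0\ \text{ on } z=\eta .$$ Assume that $\eta$ is $C^3$ and that $\phi$ is $C^3$ up to the boundary of the fluid (that is, $\phi$ has a $C^3$ extension near each point of the closed fluid domain), and that $\eta$, $\phi$ and their derivatives of order at most two are $O(|x|^{-\alpha})$ as $|x|\to\infty$ for some $\alpha>1$, uniformly in depth and locally uniformly in time. Define the pressure by $\phi_t+\tfrac12|\nabla\phi|^2+gz+p/\rho=0$, put $q(t,x)=\phi(t,x,\eta(t,x))$, and let $$\mathscr H=\tfrac12\left[\phi(\phi_z\,dx-\phi_x\,dz)+gz^2\,dx\right]$$ be the Hamiltonian one-form; along the surface from left to right it is $\tfrac12(\phi\,\nabla\phi\cdot n\,ds+gz^2dx)$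 with $n$ the upward unit normal. Let $$\omega_t=\phi(z\,dx-x\,dz)-\left(4t\mathscr H-\tfrac72gtz^2\,dx+\tfrac72gt^2\phi\,dx+\tfrac76g^2t^3z\,dx\right).$$ Then the following hold for every $t\in I$. 1. Pulled back to the surface $z=\eta$ by the parametrisation $x\mapsto(x,\eta(t,x))$, the form $\omega_t$ equals $T_7\,dx$, where $$T_7=q(\eta-x\eta_x)-4tT_2+\tfrac72gt\eta^2-\tfrac72gt^2q-\tfrac76g^2t^3\eta,\qquad T_2=\tfrac12q\eta_t+\tfrac12g\eta^2$$ ($T_7$ is the scaling-type density of Olver's list). 2. The Hamiltonian $H=\int_{z=\eta}\mathscr H$ (left to right), i.e. $H=\int_{\mathbb R}T_2\,dx$, is conserved: $dH/dt=0$. 3. The law $$\frac{d}{dt}\oint_{\partial\mathscr D}\omega_t=\int_{z=-h}\left(h+\tfrac72gt^2\right)\frac p\rho\,dx$$ holds, where $\partial\mathscr D$ is traversed counterclockwise (bottom from left to right, surface from right to left), and the boundary integrand on the left and $p/\rho$ on the right are each taken minus their values in the state of rest $\eta=0$, $\phi=0$. (The values in the state of rest are constant in $x$, so their integrals over the line diverge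 and have to be removed.) Part of the assertion is that the derivatives exist and that the integrals over the surface and over the bottom converge absolutely. -/

import Mathlib

open Filter Topology MeasureTheory

noncomputable section

namespace WaterWave

/-! Two-dimensional irrotational water waves over a flat bottom. The free surface is
`z = η t x`, the bottom is `z = -h`, and `φ t x z` is the velocity potential. -/

/-- `∂φ/∂t`. -/
def dt (φ : ℝ → ℝ → ℝ → ℝ) (t x z : ℝ) : ℝ := deriv (fun s => φ s x z) t

/-- `∂φ/∂x`. -/
def dx (φ : ℝ → ℝ → ℝ → ℝ) (t x z : ℝ) : ℝ := deriv (fun y => φ t y z) x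

/-- `∂φ/∂z`. -/
def dz (φ : ℝ → ℝ → ℝ → ℝ) (t x z : ℝ) : ℝ := deriv (fun w => φ t x w) z

/-- The slope `∂η/∂x` of the free surface. -/
def slope (η : ℝ → ℝ → ℝ) (t x : ℝ) : ℝ := deriv (fun y => η t y) x

/-- The vertical speed `∂η/∂t` of the free surface. -/
def surfaceSpeed (η : ℝ → ℝ → ℝ) (t x : ℝ) : ℝ := deriv (fun s => η s x) t

/-- A classical solution, on the open set `I` of times, of the one-dimensional free-surface
water-wave problem without surface tension on the whole line, regular up to the boundary
and decaying as `|x| → ∞`. The values of `φ` outside the closed fluid domain only serve to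
express regularity up to the boundary; nothing else is required of them. -/
structure IsSolution (g h : ℝ) (I : Set ℝ) (η : ℝ → ℝ → ℝ) (φ : ℝ → ℝ → ℝ → ℝ) : Prop where
  /-- the surface stays above the bottom -/
  above_bottom : ∀ t ∈ I, ∀ x, -h < η t x
  smooth_surface : ∀ t ∈ I, ∀ x,
    ContDiffAt ℝ 3 (fun y : ℝ × ℝ => η y.1 y.2) (t, x)
  smooth_potential : ∀ t ∈ I, ∀ x z, -h ≤ z → z ≤ η t x →
    ContDiffAt ℝ 3 (fun y : ℝ × ℝ × ℝ => φ y.1 y.2.1 y.2.2) (t, x, z)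
  /-- Laplace's equation in the fluid -/
  laplace : ∀ t ∈ I, ∀ x z, -h < z → z < η t x →
    iteratedDeriv 2 (fun y => φ t y z) x + iteratedDeriv 2 (fun w => φ t x w) z = 0
  /-- no flow through the bottom -/
  bottom : ∀ t ∈ I, ∀ x, dz φ t x (-h) = 0
  /-- kinematic condition at the free surface -/
  kinematic : ∀ t ∈ I, ∀ x,
    surfaceSpeed η t x = dz φ t x (η t x) - dx φ t x (η t x) * slope η t x
  /-- dynamic condition at the free surface -/
  dynamic : ∀ t ∈ I, ∀ x,
    dt φ t x (η t x) + (dx φ t x (η t x) ^ 2 + dz φ t x (η t x) ^ 2) / 2 + g * η t x = 0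
  /-- `η`, `φ` and their derivatives of order at most two decay like `|x| ^ (-α)` for some
  `α > 1`, locally uniformly in time and uniformly in depth -/
  decay : ∀ t₀ ∈ I, ∃ C : ℝ, ∃ α : ℝ, 1 < α ∧ ∀ᶠ t in 𝓝 t₀, ∀ k : ℕ, k ≤ 2 → ∀ x : ℝ,
    ‖iteratedFDeriv ℝ k (fun y : ℝ × ℝ => η y.1 y.2) (t, x)‖ ≤ C * (1 + |x|) ^ (-α) ∧
    ∀ z, -h ≤ z → z ≤ η t x →
      ‖iteratedFDeriv ℝ k (fun y : ℝ × ℝ × ℝ => φ y.1 y.2.1 y.2.2) (t, x, z)‖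
        ≤ C * (1 + |x|) ^ (-α)

/-- The pressure in the fluid, from Bernoulli's equation
`φ_t + |∇φ|² / 2 + g z + p / ρ = 0` (zero at the free surface). -/
def pressure (ρ g : ℝ) (φ : ℝ → ℝ → ℝ → ℝ) (t x z : ℝ) : ℝ :=
  -ρ * (dt φ t x z + (dx φ t x z ^ 2 + dz φ t x z ^ 2) / 2 + g * z)

/-- `dx`-coefficient of the Hamiltonian one-form `½ (φ (φ_z dx - φ_x dz) + g z² dx)`. Along
the surface, traversed to the right, `φ_z dx - φ_x dz` is `∇φ · n ds` with `n` the upward unit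
normal. -/
def hamP (g : ℝ) (φ : ℝ → ℝ → ℝ → ℝ) (t x z : ℝ) : ℝ :=
  (φ t x z * dz φ t x z + g * z ^ 2) / 2

/-- `dz`-coefficient of the Hamiltonian one-form. -/
def hamQ (φ : ℝ → ℝ → ℝ → ℝ) (t x z : ℝ) : ℝ :=
  -(φ t x z * dx φ t x z) / 2

/-- The integrand (in `x`) of a one-form `P dx + Q dz` along the surface `z = η t x`. -/
def alongSurface (η : ℝ → ℝ → ℝ) (t : ℝ) (P Q : ℝ → ℝ → ℝ) (x : ℝ) : ℝ :=
  P x (η t x) + Q x (η t x) * slope η t x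

/-- The Hamiltonian `∫ ½ (φ ∇φ · n ds + g z² dx)` over the free surface. -/
def hamiltonian (g : ℝ) (η : ℝ → ℝ → ℝ) (φ : ℝ → ℝ → ℝ → ℝ) (t : ℝ) : ℝ :=
  ∫ x, alongSurface η t (hamP g φ t) (hamQ φ t) x

/-- `dx`-coefficient of the one-form
`φ (z dx - x dz) - (4 t 𝓗 - (7/2) g t z² dx + (7/2) g t² φ dx + (7/6) g² t³ z dx)`, where `𝓗` is
the Hamiltonian one-form. -/
def lawP (g : ℝ) (φ : ℝ → ℝ → ℝ → ℝ) (t x z : ℝ) : ℝ :=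
  φ t x z * z - (4 * t * hamP g φ t x z - 7 / 2 * g * t * z ^ 2
    + 7 / 2 * g * t ^ 2 * φ t x z + 7 / 6 * g ^ 2 * t ^ 3 * z)

/-- `dz`-coefficient of the same one-form. -/
def lawQ (φ : ℝ → ℝ → ℝ → ℝ) (t x z : ℝ) : ℝ :=
  -(φ t x z * x) - 4 * t * hamQ φ t x z

/-- Integrand, on the surface, of the one-form of the law for the wave minus that for the state
of rest (`η = 0`, `φ = 0`). -/
def surfaceExcess (g : ℝ) (η : ℝ → ℝ → ℝ) (φ : ℝ → ℝ → ℝ → ℝ) (t x : ℝ) : ℝ :=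
  alongSurface η t (lawP g φ t) (lawQ φ t) x - alongSurface 0 t (lawP g 0 t) (lawQ 0 t) x

/-- Integrand, on the bottom (where `dz = 0`), of the one-form of the law for the wave minus
that for the state of rest. -/
def bottomExcess (g h : ℝ) (φ : ℝ → ℝ → ℝ → ℝ) (t x : ℝ) : ℝ :=
  lawP g φ t x (-h) - lawP g 0 t x (-h)

/-- The contour integral of the one-form of the law over the boundary of the fluid domain,
counterclockwise (bottom to the right, surface to the left), relative to the state of rest. -/
def contourExcess (g h : ℝ) (η : ℝ → ℝ → ℝ) (φ : ℝ → ℝ → ℝ → ℝ) (t : ℝ) : ℝ :=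
  (∫ x, bottomExcess g h φ t x) - ∫ x, surfaceExcess g η φ t x

/-- `p / ρ` on the bottom, minus its value in the state of rest. -/
def bottomPressureExcess (ρ g h : ℝ) (φ : ℝ → ℝ → ℝ → ℝ) (t x : ℝ) : ℝ :=
  pressure ρ g φ t x (-h) / ρ - pressure ρ g 0 t x (-h) / ρ

/-- The energy density `T₂ = ½ q η_t + ½ g η²`, where `q t x = φ t x (η t x)`. -/
def T2 (g : ℝ) (η : ℝ → ℝ → ℝ) (φ : ℝ → ℝ → ℝ → ℝ) (t x : ℝ) : ℝ :=
  1 / 2 * φ t x (η t x) * surfaceSpeed η t x + 1 / 2 * g * η t x ^ 2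

/-- The surface density `T₇ = q (η - x η_x) - 4 t T₂ + (7/2) g t η² - (7/2) g t² q
- (7/6) g² t³ η`. -/
def T7 (g : ℝ) (η : ℝ → ℝ → ℝ) (φ : ℝ → ℝ → ℝ → ℝ) (t x : ℝ) : ℝ :=
  φ t x (η t x) * (η t x - x * slope η t x) - 4 * t * T2 g η φ t x
    + 7 / 2 * g * t * η t x ^ 2 - 7 / 2 * g * t ^ 2 * φ t x (η t x)
    - 7 / 6 * g ^ 2 * t ^ 3 * η t x

end WaterWave

end

/-! The contour integral reduces to finitely many moments whose rates of change are explicit. By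
`SolutionDecay.contourExcess_eq` it is a combination, with coefficients polynomial in t, of B = ∫φ
over the bottom and, over the surface, of M = ∫η, Q = ∫q, V = ∫η², S = ∫q(η - xη_x) and the
Hamiltonian H. With U = ∫φ_x² over the bottom, the rates are M' = 0, Q' = -gM - U/2, V' = 2Q - 2B,
H' = 0, S' = 4H - (7/2)gV + (h/2)U. The polynomials in t are chosen so that M, Q, V, H and B all
cancel when the combination is differentiated. What is left is -(h + (7/2)gt²)(B' + U/2), and
Bernoulli's equation on the bottom, where φ_z = 0, identifies -(B' + U/2) as the integral of the
excess of p/ρ.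

Each surface rate is found in the same way. The decay allows differentiation under the integral; the
kinematic and dynamic conditions rewrite the resulting density as the flux of a divergence-free
field through the surface, up to multiples of other densities and x-derivatives of decaying
functions. `IsSolution.flux` then carries the flux to the bottom, where φ_z = 0 simplifies it.

The fields are ∇φ for M, and those of Green's second identity for the harmonic pairs (z, φ) for V
and (φ, φ_t) for H. For Q and S, note that W = φ_x - iφ_z is analytic in x + iz, and that (Re f, -Im
f) is divergence-free for analytic f: the choices are f = ½iW² for Q and f = ½(x + iz)W² for S. The
factor x costs one power of |x|, which α > 1 pays for because it always multiplies two decaying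
factors. -/

noncomputable section

namespace WaterWave

/-! ### The divergence theorem between the bottom and the surface -/

/-- Leibniz' rule for an integral with one moving endpoint, for an integrand that is `C¹` near
the segment of integration. -/
theorem hasDerivAt_integral_moving_endpoint {F : ℝ → ℝ → ℝ} {b x₀ ζ' : ℝ} {ζ : ℝ → ℝ}
    (hζ : HasDerivAt ζ ζ' x₀) (hb : b ≤ ζ x₀)
    (hF : ∀ z ∈ Set.Icc b (ζ x₀), ContDiffAt ℝ 1 (fun p : ℝ × ℝ => F p.1 p.2) (x₀, z)) :
    HasDerivAt (fun x => ∫ z in b..ζ x, F x z)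
      ((∫ z in b..ζ x₀, fderiv ℝ (fun p : ℝ × ℝ => F p.1 p.2) (x₀, z) (1, 0))
        + ζ' * F x₀ (ζ x₀)) x₀ := by
  set f : ℝ × ℝ → ℝ := fun p => F p.1 p.2 with hf
  have hmem : ζ x₀ ∈ Set.Icc b (ζ x₀) := ⟨hb, le_rfl⟩
  have hf'c : ∀ z ∈ Set.Icc b (ζ x₀), ContinuousAt (fun p => fderiv ℝ f p (1, 0)) (x₀, z) := by
    intro z hz
    have := ((hF z hz).fderiv_right (m := 0) le_rfl).continuousAt
    exact this.clm_apply continuousAt_const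
  have hpair : ∀ z : ℝ, ContinuousAt (fun w : ℝ => (x₀, w)) z := fun z => by fun_prop
  have hf'on : ContinuousOn (fun z => fderiv ℝ f (x₀, z) (1, 0)) (Set.Icc b (ζ x₀)) := fun z hz =>
    (ContinuousAt.comp (f := fun w : ℝ => (x₀, w)) (hf'c z hz) (hpair z)).continuousWithinAt
  obtain ⟨M, hM⟩ := isCompact_Icc.exists_bound_of_continuousOn hf'on
  -- Compactness of the segment makes the neighbourhood of `x₀` uniform in z; the slack in `M + 1`
  -- lets the bound persist away from `x₀`.
  have hev : ∀ᶠ x in 𝓝 x₀, ∀ z ∈ Set.Icc b (ζ x₀),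
      ContDiffAt ℝ 1 f (x, z) ∧ ‖fderiv ℝ f (x, z) (1, 0)‖ ≤ M + 1 := by
    apply isCompact_Icc.eventually_forall_of_forall_eventually
    intro z hz
    have h1 : ∀ᶠ p in 𝓝 (x₀, z), ContDiffAt ℝ 1 f p := (hF z hz).eventually (by simp)
    have h2 : ∀ᶠ p in 𝓝 (x₀, z), ‖fderiv ℝ f p (1, 0)‖ < M + 1 :=
      (hf'c z hz).norm.eventually_lt_const (by have := hM z hz; linarith)
    filter_upwards [h1, h2] with p hp1 hp2 using ⟨hp1, hp2.le⟩
  have hslice : ∀ x z, ContDiffAt ℝ 1 f (x, z) → ContinuousAt (F x) z := fun x z hxz =>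
    ContinuousAt.comp (f := fun w : ℝ => (x, w)) hxz.continuousAt
      (by fun_prop)
  have hint1 : ∀ᶠ x in 𝓝 x₀, IntervalIntegrable (F x) volume b (ζ x₀) := by
    filter_upwards [hev] with x hx
    apply ContinuousOn.intervalIntegrable
    rw [Set.uIcc_of_le hb]
    exact fun z hz => (hslice x z (hx z hz).1).continuousWithinAt
  have hfixed : HasDerivAt (fun x => ∫ z in b..ζ x₀, F x z)
      (∫ z in b..ζ x₀, fderiv ℝ f (x₀, z) (1, 0)) x₀ := by
    refine (intervalIntegral.hasDerivAt_integral_of_dominated_loc_of_deriv_le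
      (F := F) (F' := fun x z => fderiv ℝ f (x, z) (1, 0)) (bound := fun _ => M + 1)
      hev ?_ hint1.self_of_nhds ?_ ?_ (by simp) ?_).2
    · exact hint1.mono fun x hx => hx.def'.aestronglyMeasurable
    · have : IntervalIntegrable (fun z => fderiv ℝ f (x₀, z) (1, 0)) volume b (ζ x₀) := by
        apply ContinuousOn.intervalIntegrable
        rwa [Set.uIcc_of_le hb]
      exact this.def'.aestronglyMeasurable
    · refine Eventually.of_forall fun z hz x hx => (hx z ?_).2
      rw [Set.uIoc_of_le hb] at hz
      exact Set.Ioc_subset_Icc_self hz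
    · refine Eventually.of_forall fun z hz x hx => ?_
      rw [Set.uIoc_of_le hb] at hz
      have hd := ((hx z (Set.Ioc_subset_Icc_self hz)).1.differentiableAt (by simp)).hasFDerivAt
      exact hd.comp_hasDerivAt x ((hasDerivAt_id x).prodMk (hasDerivAt_const x z))
  obtain ⟨δ, hδ, hball⟩ := Metric.eventually_nhds_iff.1
    ((hF _ hmem).eventually (n := 1) (by simp))
  have hζc := hζ.continuousAt
  have hnear : ∀ ε > 0, ∀ᶠ x in 𝓝 x₀, ∀ z ∈ Set.uIcc (ζ x₀) (ζ x), dist (x, z) (x₀, ζ x₀) < ε := by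
    intro ε hε
    filter_upwards [Metric.ball_mem_nhds x₀ hε, hζc (Metric.ball_mem_nhds _ hε)] with x hx hx' z hz
    have h1 : |z - ζ x₀| ≤ |ζ x - ζ x₀| := Set.abs_sub_left_of_mem_uIcc hz
    have h2 : |ζ x - ζ x₀| < ε := hx'
    exact max_lt hx (lt_of_le_of_lt h1 h2)
  have hint2 : ∀ᶠ x in 𝓝 x₀, IntervalIntegrable (F x) volume (ζ x₀) (ζ x) := by
    filter_upwards [hnear δ hδ] with x hx
    exact ContinuousOn.intervalIntegrable fun z hz =>
      (hslice x z (hball (hx z hz))).continuousWithinAt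
  have hmoving : HasDerivAt (fun x => ∫ z in ζ x₀..ζ x, F x z) (ζ' * F x₀ (ζ x₀)) x₀ := by
    -- Between the old and the new endpoint F is nearly its value at the corner (x₀, ζ x₀), so the
    -- error is small relative to the length of that piece.
    have hsmall : (fun x => (∫ z in ζ x₀..ζ x, F x z) - (ζ x - ζ x₀) * F x₀ (ζ x₀))
        =o[𝓝 x₀] fun x => ζ x - ζ x₀ := by
      rw [Asymptotics.isLittleO_iff]
      intro c hc
      obtain ⟨ε, hε, hcont⟩ := Metric.continuousAt_iff.1 (hF _ hmem).continuousAt c hc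
      filter_upwards [hnear ε hε, hint2] with x hx hi
      have heq : (∫ z in ζ x₀..ζ x, F x z) - (ζ x - ζ x₀) * F x₀ (ζ x₀)
          = ∫ z in ζ x₀..ζ x, (F x z - F x₀ (ζ x₀)) := by
        rw [intervalIntegral.integral_sub hi (by simp)]
        simp
      rw [heq]
      refine intervalIntegral.norm_integral_le_of_norm_le_const fun z hz => ?_
      exact (hcont (hx z (Set.uIoc_subset_uIcc hz))).le
    have h1 : (fun x => (∫ z in ζ x₀..ζ x, F x z) - (ζ x - ζ x₀) * F x₀ (ζ x₀))
        =o[𝓝 x₀] fun x => x - x₀ := hsmall.trans_isBigO hζ.isBigO_sub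
    have h2 := (hasDerivAt_iff_isLittleO.1 (hζ.mul_const (F x₀ (ζ x₀))))
    rw [hasDerivAt_iff_isLittleO]
    refine (h1.add h2).congr_left fun x => ?_
    simp only [intervalIntegral.integral_same, smul_eq_mul]
    ring
  refine (hfixed.add hmoving).congr_of_eventuallyEq ?_
  filter_upwards [hint1, hint2] with x h1 h2
  exact (intervalIntegral.integral_add_adjacent_intervals h1 h2).symm

/-! ### The weight (1 + |x|)^(-α) and the flux identity. -/

theorem tendsto_weight {α : ℝ} (hα : 0 < α) {l : Filter ℝ} (hl : Tendsto (fun x : ℝ => |x|) l atTop) :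
    Tendsto (fun x : ℝ => (1 + |x|) ^ (-α)) l (𝓝 0) :=
  (tendsto_rpow_neg_atTop hα).comp (tendsto_atTop_add_const_left _ 1 hl)

theorem weight_nonneg (α x : ℝ) : 0 ≤ (1 + |x|) ^ (-α) := by positivity

theorem weight_le_one {α : ℝ} (hα : 0 ≤ α) (x : ℝ) : (1 + |x|) ^ (-α) ≤ 1 :=
  Real.rpow_le_one_of_one_le_of_nonpos (by linarith [abs_nonneg x]) (by linarith)

theorem abs_mul_weight_le_one {α : ℝ} (hα : 1 ≤ α) (x : ℝ) : |x| * (1 + |x|) ^ (-α) ≤ 1 := by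
  have h0 : 0 < 1 + |x| := by positivity
  calc |x| * (1 + |x|) ^ (-α) ≤ (1 + |x|) ^ (1 : ℝ) * (1 + |x|) ^ (-α) := by
        rw [Real.rpow_one]; gcongr; linarith
    _ = (1 + |x|) ^ (1 - α) := by rw [← Real.rpow_add h0, sub_eq_add_neg]
    _ ≤ 1 := Real.rpow_le_one_of_one_le_of_nonpos (by linarith [abs_nonneg x]) (by linarith)

theorem integrable_weight {α : ℝ} (hα : 1 < α) : Integrable fun x : ℝ => (1 + |x|) ^ (-α) := by
  simpa using integrable_one_add_norm (E := ℝ) (r := α) (μ := volume) (by simpa using hα)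

/-- A divergence-free field `(F, G)`, `C¹` up to the boundary and with decaying horizontal
component, has the same flux through the surface as through the bottom. -/
theorem flux_surface_eq_flux_bottom {h α C K : ℝ} (hα : 0 < α) {ζ ζ' : ℝ → ℝ}
    (hζ : ∀ x, HasDerivAt ζ (ζ' x) x) (habove : ∀ x, -h < ζ x) (hK : ∀ x, |ζ x| ≤ K)
    {F G : ℝ → ℝ → ℝ}
    (hF : ∀ x z, -h ≤ z → z ≤ ζ x → ContDiffAt ℝ 1 (fun p : ℝ × ℝ => F p.1 p.2) (x, z))
    (hG : ∀ x z, -h ≤ z → z ≤ ζ x → ContinuousAt (fun p : ℝ × ℝ => G p.1 p.2) (x, z))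
    (hdiv : ∀ x z, -h < z → z < ζ x →
      ∃ a, HasDerivAt (fun y => F y z) a x ∧ HasDerivAt (fun w => G x w) (-a) z)
    (hdecay : ∀ x z, -h ≤ z → z ≤ ζ x → |F x z| ≤ C * (1 + |x|) ^ (-α))
    (hsurf : Integrable fun x => G x (ζ x) - ζ' x * F x (ζ x))
    (hbot : Integrable fun x => G x (-h)) :
    ∫ x, (G x (ζ x) - ζ' x * F x (ζ x)) = ∫ x, G x (-h) := by
  set f : ℝ × ℝ → ℝ := fun p => F p.1 p.2 with hf
  -- Here F_x = -G_z is integrated in z. The divergence is known to vanish only in the open segment;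
  -- continuity of G covers the endpoints.
  have hslab : ∀ x, ∫ z in -h..ζ x, fderiv ℝ f (x, z) (1, 0) = G x (-h) - G x (ζ x) := by
    intro x
    have hder : ∀ z ∈ Set.Ioo (-h) (ζ x),
        HasDerivAt (fun w => -G x w) (fderiv ℝ f (x, z) (1, 0)) z := by
      intro z hz
      obtain ⟨a, ha, ha'⟩ := hdiv x z hz.1 hz.2
      have hd := ((hF x z hz.1.le hz.2.le).differentiableAt (by simp)).hasFDerivAt
      have hd' : HasDerivAt (fun y => F y z) (fderiv ℝ f (x, z) (1, 0)) x :=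
        HasFDerivAt.comp_hasDerivAt (f := fun y => (y, z)) x hd
          ((hasDerivAt_id x).prodMk (hasDerivAt_const x z))
      rw [hd'.unique ha]
      simpa using ha'.fun_neg
    have hcont : ContinuousOn (fun w => -G x w) (Set.Icc (-h) (ζ x)) := fun z hz =>
      (ContinuousAt.comp (f := fun w : ℝ => (x, w)) (hG x z hz.1 hz.2)
        (by fun_prop)).neg.continuousWithinAt
    have hint : IntervalIntegrable (fun z => fderiv ℝ f (x, z) (1, 0)) volume (-h) (ζ x) := by
      apply ContinuousOn.intervalIntegrable
      rw [Set.uIcc_of_le (habove x).le]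
      intro z hz
      have h1 := ((hF x z hz.1 hz.2).fderiv_right (m := 0) le_rfl).continuousAt
      have h2 : ContinuousAt (fun p => fderiv ℝ f p (1, 0)) (x, z) :=
        h1.clm_apply continuousAt_const
      exact (ContinuousAt.comp (f := fun w : ℝ => (x, w)) h2
        (by fun_prop)).continuousWithinAt
    rw [intervalIntegral.integral_eq_sub_of_hasDerivAt_of_le (habove x).le hcont hder hint]
    ring
  -- The horizontal flux through a vertical section varies in x by the bottom flux minus the surface
  -- flux. It tends to zero at both ends, so the two total fluxes agree.
  have hder : ∀ x, HasDerivAt (fun x => ∫ z in -h..ζ x, F x z)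
      (G x (-h) - (G x (ζ x) - ζ' x * F x (ζ x))) x := by
    intro x
    refine (hasDerivAt_integral_moving_endpoint (hζ x) (habove x).le
      fun z hz => hF x z hz.1 hz.2).congr_deriv ?_
    rw [hslab x]
    ring
  have hle : ∀ x, ‖∫ z in -h..ζ x, F x z‖ ≤ |C| * (K + |h|) * (1 + |x|) ^ (-α) := by
    intro x
    have h1 : ‖∫ z in -h..ζ x, F x z‖ ≤ |C| * (1 + |x|) ^ (-α) * |ζ x - -h| := by
      refine intervalIntegral.norm_integral_le_of_norm_le_const fun z hz => ?_
      rw [Set.uIoc_of_le (habove x).le] at hz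
      refine (hdecay x z hz.1.le hz.2).trans ?_
      gcongr
      exact le_abs_self C
    have h2 : |ζ x - -h| ≤ K + |h| := by
      rw [sub_neg_eq_add]
      exact (abs_add_le _ _).trans (by linarith [hK x])
    refine h1.trans ?_
    have := weight_nonneg α x
    calc |C| * (1 + |x|) ^ (-α) * |ζ x - -h| ≤ |C| * (1 + |x|) ^ (-α) * (K + |h|) := by gcongr
      _ = _ := by ring
  have hlim : ∀ l : Filter ℝ, Tendsto (fun x : ℝ => |x|) l atTop →
      Tendsto (fun x => ∫ z in -h..ζ x, F x z) l (𝓝 0) := fun l hl => by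
    refine squeeze_zero_norm hle ?_
    simpa using (tendsto_weight hα hl).const_mul (|C| * (K + |h|))
  have hzero := integral_of_hasDerivAt_of_tendsto hder (hbot.sub hsurf)
    (hlim _ tendsto_abs_atBot_atTop) (hlim _ tendsto_abs_atTop_atTop)
  rw [integral_sub hbot hsurf] at hzero
  linarith

/-! ### Decaying functions of time and position -/

/-- `f t x` is continuous in `x` and `O((1 + |x|) ^ (-α))`, uniformly for `t` near `t₀`. -/
structure Decaying (α t₀ : ℝ) (f : ℝ → ℝ → ℝ) : Prop where
  continuous : ∀ᶠ t in 𝓝 t₀, Continuous (f t)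
  bound : ∃ C, ∀ᶠ t in 𝓝 t₀, ∀ x, |f t x| ≤ C * (1 + |x|) ^ (-α)

namespace Decaying

variable {α t₀ : ℝ} {f g : ℝ → ℝ → ℝ}

theorem congr (hf : Decaying α t₀ f) (h : ∀ᶠ t in 𝓝 t₀, ∀ x, g t x = f t x) :
    Decaying α t₀ g := by
  obtain ⟨C, hC⟩ := hf.bound
  constructor
  · filter_upwards [hf.continuous, h] with t ht hg
    rwa [funext hg]
  · refine ⟨C, ?_⟩
    filter_upwards [hC, h] with t ht hg x
    rw [hg]
    exact ht x

theorem add (hf : Decaying α t₀ f) (hg : Decaying α t₀ g) :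
    Decaying α t₀ fun t x => f t x + g t x := by
  obtain ⟨C, hC⟩ := hf.bound
  obtain ⟨D, hD⟩ := hg.bound
  constructor
  · filter_upwards [hf.continuous, hg.continuous] with t h1 h2 using h1.add h2
  · refine ⟨C + D, ?_⟩
    filter_upwards [hC, hD] with t h1 h2 x
    calc |f t x + g t x| ≤ |f t x| + |g t x| := abs_add_le _ _
      _ ≤ _ := add_le_add (h1 x) (h2 x)
      _ = _ := by ring

theorem const_mul (hf : Decaying α t₀ f) (c : ℝ) : Decaying α t₀ fun t x => c * f t x := by
  obtain ⟨C, hC⟩ := hf.bound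
  constructor
  · filter_upwards [hf.continuous] with t h1 using h1.const_mul c
  · refine ⟨|c| * C, ?_⟩
    filter_upwards [hC] with t h1 x
    rw [abs_mul, mul_assoc]
    exact mul_le_mul_of_nonneg_left (h1 x) (abs_nonneg c)

theorem div_const (hf : Decaying α t₀ f) (c : ℝ) : Decaying α t₀ fun t x => f t x / c := by
  simpa only [div_eq_inv_mul] using hf.const_mul c⁻¹

theorem neg (hf : Decaying α t₀ f) : Decaying α t₀ fun t x => -f t x := by
  simpa only [neg_one_mul] using hf.const_mul (-1)

theorem sub (hf : Decaying α t₀ f) (hg : Decaying α t₀ g) :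
    Decaying α t₀ fun t x => f t x - g t x := by
  simpa only [sub_eq_add_neg] using hf.add hg.neg

theorem mul (hα : 0 ≤ α) (hf : Decaying α t₀ f) (hg : Decaying α t₀ g) :
    Decaying α t₀ fun t x => f t x * g t x := by
  obtain ⟨C, hC⟩ := hf.bound
  obtain ⟨D, hD⟩ := hg.bound
  constructor
  · filter_upwards [hf.continuous, hg.continuous] with t h1 h2 using h1.mul h2
  · refine ⟨C * |D|, ?_⟩
    filter_upwards [hC, hD] with t h1 h2 x
    have hw := weight_nonneg α x
    have h3 : |g t x| ≤ |D| := (h2 x).trans <| by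
      calc D * (1 + |x|) ^ (-α) ≤ |D| * 1 :=
            mul_le_mul (le_abs_self D) (weight_le_one hα x) hw (abs_nonneg D)
        _ = |D| := mul_one _
    rw [abs_mul]
    calc |f t x| * |g t x| ≤ C * (1 + |x|) ^ (-α) * |D| :=
          mul_le_mul (h1 x) h3 (abs_nonneg _) ((abs_nonneg _).trans (h1 x))
      _ = _ := by ring

/-- One decaying factor absorbs x, leaving something bounded, and the other keeps the full decay.
This handles the terms of the scaling density that grow with x. -/
theorem id_mul_mul (hα : 1 ≤ α) (hf : Decaying α t₀ f) (hg : Decaying α t₀ g) :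
    Decaying α t₀ fun t x => x * f t x * g t x := by
  obtain ⟨C, hC⟩ := hf.bound
  obtain ⟨D, hD⟩ := hg.bound
  constructor
  · filter_upwards [hf.continuous, hg.continuous] with t h1 h2 using
      (continuous_id.mul h1).mul h2
  · refine ⟨|C| * D, ?_⟩
    filter_upwards [hC, hD] with t h1 h2 x
    have h3 : |x * f t x| ≤ |C| := by
      rw [abs_mul]
      calc |x| * |f t x| ≤ |x| * (C * (1 + |x|) ^ (-α)) :=
            mul_le_mul_of_nonneg_left (h1 x) (abs_nonneg x)
        _ = C * (|x| * (1 + |x|) ^ (-α)) := by ring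
        _ ≤ |C| * 1 := mul_le_mul (le_abs_self C) (abs_mul_weight_le_one hα x)
            (mul_nonneg (abs_nonneg x) (weight_nonneg α x)) (abs_nonneg C)
        _ = |C| := mul_one _
    rw [abs_mul, mul_assoc |C|]
    exact mul_le_mul h3 (h2 x) (abs_nonneg _) (abs_nonneg C)

theorem integrable (hα : 1 < α) (hf : Decaying α t₀ f) : Integrable (f t₀) := by
  obtain ⟨C, hC⟩ := hf.bound
  exact ((integrable_weight hα).const_mul C).mono'
    hf.continuous.self_of_nhds.aestronglyMeasurable (Eventually.of_forall hC.self_of_nhds)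

theorem exists_abs_le (hα : 0 ≤ α) (hf : Decaying α t₀ f) : ∃ K, ∀ x, |f t₀ x| ≤ K := by
  obtain ⟨C, hC⟩ := hf.bound
  refine ⟨|C|, fun x => (hC.self_of_nhds x).trans ?_⟩
  calc C * (1 + |x|) ^ (-α) ≤ |C| * 1 :=
        mul_le_mul (le_abs_self C) (weight_le_one hα x) (weight_nonneg α x) (abs_nonneg C)
    _ = |C| := mul_one _

/-- Differentiation under the integral over the line. -/
theorem hasDerivAt_integral (hα : 1 < α) (hf : Decaying α t₀ f) (hg : Decaying α t₀ g)
    (hfg : ∀ᶠ t in 𝓝 t₀, ∀ x, HasDerivAt (fun s => f s x) (g t x) t) :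
    HasDerivAt (fun t => ∫ x, f t x) (∫ x, g t₀ x) t₀ := by
  obtain ⟨C, hC⟩ := hg.bound
  exact (hasDerivAt_integral_of_dominated_loc_of_deriv_le (hC.and hfg)
    (hf.continuous.mono fun t ht => ht.aestronglyMeasurable) (hf.integrable hα)
    hg.continuous.self_of_nhds.aestronglyMeasurable
    (Eventually.of_forall fun x t ht => ht.1 x) ((integrable_weight hα).const_mul C)
    (Eventually.of_forall fun x t ht => ht.2 x)).2

/-- The `x`-derivative of a decaying function has integral zero. -/
theorem integral_eq_zero_of_hasDerivAt (hα : 1 < α) (hf : Decaying α t₀ f)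
    (hg : Decaying α t₀ g) (hfg : ∀ x, HasDerivAt (f t₀) (g t₀ x) x) : ∫ x, g t₀ x = 0 := by
  obtain ⟨C, hC⟩ := hf.bound
  have hlim : ∀ l : Filter ℝ, Tendsto (fun x : ℝ => |x|) l atTop → Tendsto (f t₀) l (𝓝 0) :=
    fun l hl => by
      refine squeeze_zero_norm hC.self_of_nhds ?_
      simpa using (tendsto_weight (by linarith : (0 : ℝ) < α) hl).const_mul C
  rw [integral_of_hasDerivAt_of_tendsto hfg (hg.integrable hα)
    (hlim _ tendsto_abs_atBot_atTop) (hlim _ tendsto_abs_atTop_atTop), sub_zero]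

end Decaying

/-! ### Directional derivatives -/

/-- The derivative of `F` in the direction `v`. -/
def pd {E : Type*} [NormedAddCommGroup E] [NormedSpace ℝ E] (v : E) (F : E → ℝ) (p : E) : ℝ :=
  fderiv ℝ F p v

section pd

variable {E : Type*} [NormedAddCommGroup E] [NormedSpace ℝ E] {F : E → ℝ} {p v w : E}

theorem contDiffAt_pd {n m : WithTop ℕ∞} (hF : ContDiffAt ℝ n F p) (hmn : m + 1 ≤ n) :
    ContDiffAt ℝ m (pd v F) p :=
  (hF.fderiv_right hmn).clm_apply contDiffAt_const

theorem pd_congr {G : E → ℝ} (h : F =ᶠ[𝓝 p] G) : pd v F p = pd v G p := by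
  rw [pd, pd, h.fderiv_eq]

/-- Passing to the second Fréchet derivative gives both the symmetry in v, w and the bound by the
norm appearing in the decay hypothesis. -/
theorem pd_pd_eq (hF : ContDiffAt ℝ 2 F p) : pd v (pd w F) p = fderiv ℝ (fderiv ℝ F) p v w := by
  have hd : DifferentiableAt ℝ (fderiv ℝ F) p :=
    (hF.fderiv_right (m := 1) le_rfl).differentiableAt (by simp)
  have := hd.hasFDerivAt.clm_apply (hasFDerivAt_const w p)
  change fderiv ℝ (fun q => fderiv ℝ F q w) p v = _
  rw [this.fderiv]
  simp

theorem pd_comm (hF : ContDiffAt ℝ 2 F p) : pd v (pd w F) p = pd w (pd v F) p := by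
  rw [pd_pd_eq hF, pd_pd_eq hF]
  exact hF.isSymmSndFDerivAt (by simp) v w

theorem abs_pd_le (hv : ‖v‖ ≤ 1) : |pd v F p| ≤ ‖iteratedFDeriv ℝ 1 F p‖ := by
  rw [norm_iteratedFDeriv_one]
  exact ((fderiv ℝ F p).le_opNorm v).trans (mul_le_of_le_one_right (norm_nonneg _) hv)

theorem abs_pd_pd_le (hF : ContDiffAt ℝ 2 F p) (hv : ‖v‖ ≤ 1) (hw : ‖w‖ ≤ 1) :
    |pd v (pd w F) p| ≤ ‖iteratedFDeriv ℝ 2 F p‖ := by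
  rw [pd_pd_eq hF]
  have h := (iteratedFDeriv ℝ 2 F p).le_opNorm ![v, w]
  rw [iteratedFDeriv_two_apply] at h
  refine h.trans (mul_le_of_le_one_right (norm_nonneg _) ?_)
  simpa [Fin.prod_univ_two] using mul_le_one₀ hv (norm_nonneg _) hw

/-- The chain rule along a curve with velocity `v`. -/
theorem hasDerivAt_comp_pd {c : ℝ → E} {s : ℝ} (hF : DifferentiableAt ℝ F (c s))
    (hc : HasDerivAt c v s) : HasDerivAt (fun r => F (c r)) (pd v F (c s)) s :=
  hF.hasFDerivAt.comp_hasDerivAt s hc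

end pd

/-! ### Traces on the surface and the bottom -/

/-- The time direction. -/
def eT : ℝ × ℝ × ℝ := (1, 0, 0)

/-- The horizontal direction. -/
def eX : ℝ × ℝ × ℝ := (0, 1, 0)

/-- The vertical direction. -/
def eZ : ℝ × ℝ × ℝ := (0, 0, 1)

theorem norm_eT : ‖eT‖ ≤ 1 := by simp [eT, Prod.norm_def]

theorem norm_eX : ‖eX‖ ≤ 1 := by simp [eX, Prod.norm_def]

theorem norm_eZ : ‖eZ‖ ≤ 1 := by simp [eZ, Prod.norm_def]

/-- The potential as a function on space-time. -/
def pot (φ : ℝ → ℝ → ℝ → ℝ) (p : ℝ × ℝ × ℝ) : ℝ := φ p.1 p.2.1 p.2.2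

/-- The elevation as a function on space-time. -/
def elev (η : ℝ → ℝ → ℝ) (p : ℝ × ℝ) : ℝ := η p.1 p.2

/-- The trace of `F` on the surface. -/
def surf (η : ℝ → ℝ → ℝ) (F : ℝ × ℝ × ℝ → ℝ) (t x : ℝ) : ℝ := F (t, x, η t x)

/-- The trace of `F` on the bottom. -/
def bot (h : ℝ) (F : ℝ × ℝ × ℝ → ℝ) (t x : ℝ) : ℝ := F (t, x, -h)

/-- The mixed derivative `∂²η/∂t∂x`. -/
def slopeRate (η : ℝ → ℝ → ℝ) (t x : ℝ) : ℝ := pd (1, 0) (pd (0, 1) (elev η)) (t, x)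

/-- `F` is continuous in the closed fluid domain and `O((1 + |x|) ^ (-α))` there, uniformly in
depth and in time near `t₀`. -/
def FluidDecaying (h : ℝ) (η : ℝ → ℝ → ℝ) (α t₀ : ℝ) (F : ℝ × ℝ × ℝ → ℝ) : Prop :=
  ∃ C, ∀ᶠ t in 𝓝 t₀, ∀ x z, -h ≤ z → z ≤ η t x →
    ContinuousAt F (t, x, z) ∧ |F (t, x, z)| ≤ C * (1 + |x|) ^ (-α)

/-- The fluid domain at time `t`, closed. -/
def fluid (h : ℝ) (η : ℝ → ℝ → ℝ) (t : ℝ) : Set (ℝ × ℝ) :=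
  {p | -h ≤ p.2 ∧ p.2 ≤ η t p.1}

/-- The curve has constant velocity, so the second derivative has no acceleration term. This
translates Laplace's equation from one-variable derivatives into directional ones. -/
theorem iteratedDeriv_two_comp {E : Type*} [NormedAddCommGroup E] [NormedSpace ℝ E]
    {F : E → ℝ} {c : ℝ → E} {v : E} {s : ℝ} (hF : ContDiffAt ℝ 2 F (c s))
    (hc : ∀ r, HasDerivAt c v r) :
    iteratedDeriv 2 (fun r => F (c r)) s = pd v (pd v F) (c s) := by
  have hev : ∀ᶠ r in 𝓝 s, ContDiffAt ℝ 2 F (c r) :=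
    (hc s).continuousAt.eventually (hF.eventually (by simp))
  have h1 : deriv (fun r => F (c r)) =ᶠ[𝓝 s] fun r => pd v F (c r) := by
    filter_upwards [hev] with r hr
    exact (hasDerivAt_comp_pd (hr.differentiableAt (by simp)) (hc r)).deriv
  rw [iteratedDeriv_succ, iteratedDeriv_one, h1.deriv_eq]
  exact (hasDerivAt_comp_pd ((contDiffAt_pd (m := 1) hF le_rfl).differentiableAt (by simp))
    (hc s)).deriv

section lines

variable (t x z : ℝ)

theorem hasDerivAt_line_t : HasDerivAt (fun s : ℝ => (s, x, z)) eT t :=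
  (hasDerivAt_id t).prodMk ((hasDerivAt_const t x).prodMk (hasDerivAt_const t z))

theorem hasDerivAt_line_x : HasDerivAt (fun y : ℝ => (t, y, z)) eX x :=
  (hasDerivAt_const x t).prodMk ((hasDerivAt_id x).prodMk (hasDerivAt_const x z))

theorem hasDerivAt_line_z : HasDerivAt (fun w : ℝ => (t, x, w)) eZ z :=
  (hasDerivAt_const z t).prodMk ((hasDerivAt_const z x).prodMk (hasDerivAt_id z))

end lines

/-! ### Chain rules for traces, and the equations of motion in terms of traces. -/

namespace IsSolution

variable {g h t x z : ℝ} {I : Set ℝ} {η : ℝ → ℝ → ℝ} {φ : ℝ → ℝ → ℝ → ℝ}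
  {F : ℝ × ℝ × ℝ → ℝ}

theorem contDiffAt_elev (hsol : IsSolution g h I η φ) (ht : t ∈ I) (x : ℝ) :
    ContDiffAt ℝ 3 (elev η) (t, x) := hsol.smooth_surface t ht x

theorem contDiffAt_pot (hsol : IsSolution g h I η φ) (ht : t ∈ I) (hz : -h ≤ z)
    (hz' : z ≤ η t x) : ContDiffAt ℝ 3 (pot φ) (t, x, z) :=
  hsol.smooth_potential t ht x z hz hz'

theorem differentiableAt_elev (hsol : IsSolution g h I η φ) (ht : t ∈ I) (x : ℝ) :
    DifferentiableAt ℝ (elev η) (t, x) :=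
  (hsol.contDiffAt_elev ht x).differentiableAt (by simp)

theorem hasDerivAt_elev_t (hsol : IsSolution g h I η φ) (ht : t ∈ I) (x : ℝ) :
    HasDerivAt (fun s => η s x) (pd (1, 0) (elev η) (t, x)) t :=
  hasDerivAt_comp_pd (c := fun s => (s, x)) (hsol.differentiableAt_elev ht x)
    ((hasDerivAt_id t).prodMk (hasDerivAt_const t x))

theorem hasDerivAt_elev_x (hsol : IsSolution g h I η φ) (ht : t ∈ I) (x : ℝ) :
    HasDerivAt (fun y => η t y) (pd (0, 1) (elev η) (t, x)) x :=
  hasDerivAt_comp_pd (c := fun y => (t, y)) (hsol.differentiableAt_elev ht x)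
    ((hasDerivAt_const x t).prodMk (hasDerivAt_id x))

theorem surfaceSpeed_eq (hsol : IsSolution g h I η φ) (ht : t ∈ I) (x : ℝ) :
    surfaceSpeed η t x = pd (1, 0) (elev η) (t, x) := (hsol.hasDerivAt_elev_t ht x).deriv

theorem slope_eq (hsol : IsSolution g h I η φ) (ht : t ∈ I) (x : ℝ) :
    slope η t x = pd (0, 1) (elev η) (t, x) := (hsol.hasDerivAt_elev_x ht x).deriv

theorem hasDerivAt_surfaceSpeed (hsol : IsSolution g h I η φ) (ht : t ∈ I) (x : ℝ) :
    HasDerivAt (fun s => η s x) (surfaceSpeed η t x) t := by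
  rw [hsol.surfaceSpeed_eq ht]
  exact hsol.hasDerivAt_elev_t ht x

theorem hasDerivAt_slope (hsol : IsSolution g h I η φ) (ht : t ∈ I) (x : ℝ) :
    HasDerivAt (fun y => η t y) (slope η t x) x := by
  rw [hsol.slope_eq ht]
  exact hsol.hasDerivAt_elev_x ht x

theorem hasDerivAt_slope_t (hsol : IsSolution g h I η φ) (hI : IsOpen I) (ht : t ∈ I) (x : ℝ) :
    HasDerivAt (fun s => slope η s x) (slopeRate η t x) t := by
  have h1 : HasDerivAt (fun s => pd (0, 1) (elev η) (s, x)) (slopeRate η t x) t :=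
    hasDerivAt_comp_pd (c := fun s => (s, x))
      ((contDiffAt_pd (m := 2) (hsol.contDiffAt_elev ht x) le_rfl).differentiableAt (by simp))
      ((hasDerivAt_id t).prodMk (hasDerivAt_const t x))
  refine h1.congr_of_eventuallyEq ?_
  filter_upwards [hI.mem_nhds ht] with s hs using hsol.slope_eq hs x

/-- Symmetry of the mixed derivatives of η makes this the same function as the time derivative of
the slope. -/
theorem hasDerivAt_surfaceSpeed_x (hsol : IsSolution g h I η φ) (ht : t ∈ I) (x : ℝ) :
    HasDerivAt (fun y => surfaceSpeed η t y) (slopeRate η t x) x := by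
  have h1 : HasDerivAt (fun y => pd (1, 0) (elev η) (t, y)) (slopeRate η t x) x := by
    rw [slopeRate, pd_comm ((hsol.contDiffAt_elev ht x).of_le (by norm_num))]
    exact hasDerivAt_comp_pd (c := fun y => (t, y))
      ((contDiffAt_pd (m := 2) (hsol.contDiffAt_elev ht x) le_rfl).differentiableAt (by simp))
      ((hasDerivAt_const x t).prodMk (hasDerivAt_id x))
  exact h1.congr_of_eventuallyEq (Eventually.of_forall fun y => hsol.surfaceSpeed_eq ht y)

/-- The surface point above a fixed x moves in space-time with velocity `eT` + η_t `eZ`. -/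
theorem hasDerivAt_surf_t (hsol : IsSolution g h I η φ) (ht : t ∈ I)
    (hF : DifferentiableAt ℝ F (t, x, η t x)) :
    HasDerivAt (fun s => surf η F s x)
      (surf η (pd eT F) t x + surf η (pd eZ F) t x * surfaceSpeed η t x) t := by
  have hc := (hasDerivAt_id t).prodMk
    ((hasDerivAt_const t x).prodMk (hsol.hasDerivAt_surfaceSpeed ht x))
  refine (hasDerivAt_comp_pd (c := fun s => (s, x, η s x)) hF hc).congr_deriv ?_
  have : ((1 : ℝ), (0 : ℝ), surfaceSpeed η t x) = eT + surfaceSpeed η t x • eZ := by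
    simp [eT, eZ]
  rw [pd, this, map_add, map_smul, smul_eq_mul, mul_comm]
  rfl

theorem hasDerivAt_surf_x (hsol : IsSolution g h I η φ) (ht : t ∈ I)
    (hF : DifferentiableAt ℝ F (t, x, η t x)) :
    HasDerivAt (fun y => surf η F t y)
      (surf η (pd eX F) t x + surf η (pd eZ F) t x * slope η t x) x := by
  have hc := (hasDerivAt_const x t).prodMk
    ((hasDerivAt_id x).prodMk (hsol.hasDerivAt_slope ht x))
  refine (hasDerivAt_comp_pd (c := fun y => (t, y, η t y)) hF hc).congr_deriv ?_
  have : ((0 : ℝ), (1 : ℝ), slope η t x) = eX + slope η t x • eZ := by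
    simp [eX, eZ]
  rw [pd, this, map_add, map_smul, smul_eq_mul, mul_comm]
  rfl

theorem hasDerivAt_bot_t (hF : DifferentiableAt ℝ F (t, x, -h)) :
    HasDerivAt (fun s => bot h F s x) (bot h (pd eT F) t x) t :=
  hasDerivAt_comp_pd (c := fun s => (s, x, -h)) hF (hasDerivAt_line_t t x (-h))

theorem differentiableAt_pot (hsol : IsSolution g h I η φ) (ht : t ∈ I) (hz : -h ≤ z)
    (hz' : z ≤ η t x) : DifferentiableAt ℝ (pot φ) (t, x, z) :=
  (hsol.contDiffAt_pot ht hz hz').differentiableAt (by simp)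

theorem contDiffAt_pd_pot (hsol : IsSolution g h I η φ) (ht : t ∈ I) (hz : -h ≤ z)
    (hz' : z ≤ η t x) (v : ℝ × ℝ × ℝ) : ContDiffAt ℝ 2 (pd v (pot φ)) (t, x, z) :=
  contDiffAt_pd (hsol.contDiffAt_pot ht hz hz') le_rfl

theorem contDiffAt_pd_pd_pot (hsol : IsSolution g h I η φ) (ht : t ∈ I) (hz : -h ≤ z)
    (hz' : z ≤ η t x) (v w : ℝ × ℝ × ℝ) : ContDiffAt ℝ 1 (pd v (pd w (pot φ))) (t, x, z) :=
  contDiffAt_pd (hsol.contDiffAt_pd_pot ht hz hz' w) le_rfl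

theorem differentiableAt_pd_pot (hsol : IsSolution g h I η φ) (ht : t ∈ I) (hz : -h ≤ z)
    (hz' : z ≤ η t x) (v : ℝ × ℝ × ℝ) : DifferentiableAt ℝ (pd v (pot φ)) (t, x, z) :=
  (hsol.contDiffAt_pd_pot ht hz hz' v).differentiableAt (by simp)

theorem pd_comm_pot (hsol : IsSolution g h I η φ) (ht : t ∈ I) (hz : -h ≤ z)
    (hz' : z ≤ η t x) (v w : ℝ × ℝ × ℝ) :
    pd v (pd w (pot φ)) (t, x, z) = pd w (pd v (pot φ)) (t, x, z) :=
  pd_comm ((hsol.contDiffAt_pot ht hz hz').of_le (by norm_num))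

theorem dt_eq (hsol : IsSolution g h I η φ) (ht : t ∈ I) (hz : -h ≤ z) (hz' : z ≤ η t x) :
    dt φ t x z = pd eT (pot φ) (t, x, z) :=
  (hasDerivAt_comp_pd (c := fun s => (s, x, z)) (hsol.differentiableAt_pot ht hz hz')
    (hasDerivAt_line_t t x z)).deriv

theorem dx_eq (hsol : IsSolution g h I η φ) (ht : t ∈ I) (hz : -h ≤ z) (hz' : z ≤ η t x) :
    dx φ t x z = pd eX (pot φ) (t, x, z) :=
  (hasDerivAt_comp_pd (c := fun y => (t, y, z)) (hsol.differentiableAt_pot ht hz hz')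
    (hasDerivAt_line_x t x z)).deriv

theorem dz_eq (hsol : IsSolution g h I η φ) (ht : t ∈ I) (hz : -h ≤ z) (hz' : z ≤ η t x) :
    dz φ t x z = pd eZ (pot φ) (t, x, z) :=
  (hasDerivAt_comp_pd (c := fun w => (t, x, w)) (hsol.differentiableAt_pot ht hz hz')
    (hasDerivAt_line_z t x z)).deriv

theorem kinematic_surf (hsol : IsSolution g h I η φ) (ht : t ∈ I) (x : ℝ) :
    surfaceSpeed η t x
      = surf η (pd eZ (pot φ)) t x - surf η (pd eX (pot φ)) t x * slope η t x := by
  have ha := (hsol.above_bottom t ht x).le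
  rw [hsol.kinematic t ht x, hsol.dz_eq ht ha le_rfl, hsol.dx_eq ht ha le_rfl]
  rfl

theorem dynamic_surf (hsol : IsSolution g h I η φ) (ht : t ∈ I) (x : ℝ) :
    surf η (pd eT (pot φ)) t x
      = -(surf η (pd eX (pot φ)) t x ^ 2 + surf η (pd eZ (pot φ)) t x ^ 2) / 2 - g * η t x := by
  have ha := (hsol.above_bottom t ht x).le
  have := hsol.dynamic t ht x
  rw [hsol.dz_eq ht ha le_rfl, hsol.dx_eq ht ha le_rfl, hsol.dt_eq ht ha le_rfl] at this
  simp only [surf]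
  linarith

theorem bot_pd_eZ (hsol : IsSolution g h I η φ) (ht : t ∈ I) (x : ℝ) :
    bot h (pd eZ (pot φ)) t x = 0 := by
  rw [← hsol.bottom t ht x, hsol.dz_eq ht le_rfl (hsol.above_bottom t ht x).le]
  rfl

/-- The bottom is fixed, so φ_z = 0 there can be differentiated in time; φ_t inherits the condition.
-/
theorem bot_pd_eZ_eT (hsol : IsSolution g h I η φ) (hI : IsOpen I) (ht : t ∈ I) (x : ℝ) :
    bot h (pd eZ (pd eT (pot φ))) t x = 0 := by
  have ha := (hsol.above_bottom t ht x).le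
  have h1 := hasDerivAt_bot_t (hsol.differentiableAt_pd_pot ht le_rfl ha eZ)
  have h2 : (fun s => bot h (pd eZ (pot φ)) s x) =ᶠ[𝓝 t] fun _ => 0 := by
    filter_upwards [hI.mem_nhds ht] with s hs using hsol.bot_pd_eZ hs x
  have h3 := h1.unique ((hasDerivAt_const t (0 : ℝ)).congr_of_eventuallyEq h2)
  rw [bot, hsol.pd_comm_pot ht le_rfl ha]
  exact h3

theorem laplace_pd (hsol : IsSolution g h I η φ) (ht : t ∈ I) (hz : -h < z)
    (hz' : z < η t x) :
    pd eX (pd eX (pot φ)) (t, x, z) + pd eZ (pd eZ (pot φ)) (t, x, z) = 0 := by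
  have h2 : ContDiffAt ℝ 2 (pot φ) (t, x, z) :=
    (hsol.contDiffAt_pot ht hz.le hz'.le).of_le (by norm_num)
  rw [← hsol.laplace t ht x z hz hz']
  congr 1
  · exact (iteratedDeriv_two_comp (c := fun y => (t, y, z)) h2
      fun y => hasDerivAt_line_x t y z).symm
  · exact (iteratedDeriv_two_comp (c := fun w => (t, x, w)) h2
      fun w => hasDerivAt_line_z t x w).symm

/-- The open fluid is open in space-time, so identities valid in it may be differentiated, in time
as well. -/
theorem eventually_interior (hsol : IsSolution g h I η φ) (hI : IsOpen I) (ht : t ∈ I)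
    (hz : -h < z) (hz' : z < η t x) :
    ∀ᶠ p : ℝ × ℝ × ℝ in 𝓝 (t, x, z), p.1 ∈ I ∧ -h < p.2.2 ∧ p.2.2 < η p.1 p.2.1 := by
  have h1 : ContinuousAt (fun p : ℝ × ℝ × ℝ => elev η (p.1, p.2.1)) (t, x, z) :=
    ContinuousAt.comp (g := elev η) (f := fun p : ℝ × ℝ × ℝ => (p.1, p.2.1)) (x := (t, x, z))
      (hsol.contDiffAt_elev ht x).continuousAt (by fun_prop)
  have h2 : ContinuousAt (fun p : ℝ × ℝ × ℝ => p.2.2) (t, x, z) := by fun_prop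
  have h3 : ContinuousAt (fun p : ℝ × ℝ × ℝ => p.1) (t, x, z) := by fun_prop
  exact (h3.eventually (hI.mem_nhds ht)).and
    ((h2.eventually (lt_mem_nhds hz)).and (h2.eventually_lt h1 hz'))

/-- `∂φ/∂t` is harmonic in the fluid. -/
theorem laplace_pd_eT (hsol : IsSolution g h I η φ) (hI : IsOpen I) (ht : t ∈ I) (hz : -h < z)
    (hz' : z < η t x) :
    pd eX (pd eX (pd eT (pot φ))) (t, x, z) + pd eZ (pd eZ (pd eT (pot φ))) (t, x, z) = 0 := by
  have hev := hsol.eventually_interior hI ht hz hz'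
  -- The time derivative is moved outwards past one v at a time: first on a neighbourhood, so that
  -- the identity can be differentiated, then at the point. This uses three derivatives of φ.
  have hswap : ∀ v, pd v (pd v (pd eT (pot φ))) (t, x, z)
      = pd eT (pd v (pd v (pot φ))) (t, x, z) := by
    intro v
    have h1 : pd v (pd eT (pot φ)) =ᶠ[𝓝 (t, x, z)] pd eT (pd v (pot φ)) := by
      filter_upwards [hev] with p hp
      exact hsol.pd_comm_pot hp.1 hp.2.1.le hp.2.2.le v eT
    rw [pd_congr h1]
    exact pd_comm (hsol.contDiffAt_pd_pot ht hz.le hz'.le v)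
  have hd : ∀ v, DifferentiableAt ℝ (pd v (pd v (pot φ))) (t, x, z) := fun v =>
    (hsol.contDiffAt_pd_pd_pot ht hz.le hz'.le v v).differentiableAt (by simp)
  have hzero : (fun p => pd eX (pd eX (pot φ)) p + pd eZ (pd eZ (pot φ)) p)
      =ᶠ[𝓝 (t, x, z)] fun _ => 0 := by
    filter_upwards [hev] with p hp using hsol.laplace_pd hp.1 hp.2.1 hp.2.2
  have h0 := pd_congr (v := eT) hzero
  simp only [pd] at h0
  rw [hswap, hswap]
  simp only [pd]
  have h1 := fderiv_fun_add (hd eX) (hd eZ)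
  simp only [pd] at h1
  rw [h1] at h0
  simpa using h0

/-! ### Decay -/

theorem continuous_elev (hsol : IsSolution g h I η φ) (ht : t ∈ I) : Continuous (η t) :=
  continuous_iff_continuousAt.2 fun x => (hsol.hasDerivAt_slope ht x).continuousAt

theorem decaying_surf (hsol : IsSolution g h I η φ) (hI : IsOpen I) (ht : t ∈ I) {α : ℝ}
    (hF : FluidDecaying h η α t F) : Decaying α t (surf η F) := by
  obtain ⟨C, hC⟩ := hF
  constructor
  · filter_upwards [hC, hI.mem_nhds ht] with s hs hsI
    refine continuous_iff_continuousAt.2 fun x => ?_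
    exact ContinuousAt.comp (f := fun y => (s, y, η s y))
      (hs x (η s x) (hsol.above_bottom s hsI x).le le_rfl).1
      (continuousAt_const.prodMk
        (continuousAt_id.prodMk (hsol.continuous_elev hsI).continuousAt))
  · refine ⟨C, ?_⟩
    filter_upwards [hC, hI.mem_nhds ht] with s hs hsI x
    exact (hs x (η s x) (hsol.above_bottom s hsI x).le le_rfl).2

theorem decaying_bot (hsol : IsSolution g h I η φ) (hI : IsOpen I) (ht : t ∈ I) {α : ℝ}
    (hF : FluidDecaying h η α t F) : Decaying α t (bot h F) := by
  obtain ⟨C, hC⟩ := hF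
  constructor
  · filter_upwards [hC, hI.mem_nhds ht] with s hs hsI
    refine continuous_iff_continuousAt.2 fun x => ?_
    exact ContinuousAt.comp (f := fun y => (s, y, -h))
      (hs x (-h) le_rfl (hsol.above_bottom s hsI x).le).1 (by fun_prop)
  · refine ⟨C, ?_⟩
    filter_upwards [hC, hI.mem_nhds ht] with s hs hsI x
    exact (hs x (-h) le_rfl (hsol.above_bottom s hsI x).le).2

end IsSolution

/-- In Landau notation the decay of the horizontal fluxes follows from that of their factors without
tracking constants. -/
theorem FluidDecaying.isBigO {h α t : ℝ} {η : ℝ → ℝ → ℝ} {F : ℝ × ℝ × ℝ → ℝ}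
    (hF : FluidDecaying h η α t F) :
    (fun p : ℝ × ℝ => F (t, p.1, p.2)) =O[𝓟 (fluid h η t)] fun p => (1 + |p.1|) ^ (-α) := by
  obtain ⟨C, hC⟩ := hF
  refine Asymptotics.IsBigO.of_bound C ?_
  rw [eventually_principal]
  intro p hp
  rw [Real.norm_of_nonneg (weight_nonneg α p.1)]
  exact (hC.self_of_nhds p.1 p.2 hp.1 hp.2).2

/-- The decay hypothesis on a solution near the time `t`, with exponent `α`. -/
structure SolutionDecay (h : ℝ) (η : ℝ → ℝ → ℝ) (φ : ℝ → ℝ → ℝ → ℝ) (α t : ℝ) : Prop where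
  one_lt : 1 < α
  elev : Decaying α t η
  speed : Decaying α t (surfaceSpeed η)
  slope : Decaying α t (slope η)
  slopeRate : Decaying α t (slopeRate η)
  pot : FluidDecaying h η α t (pot φ)
  pd_pot : ∀ v, ‖v‖ ≤ 1 → FluidDecaying h η α t (pd v (WaterWave.pot φ))
  pd_pd_pot : ∀ v w, ‖v‖ ≤ 1 → ‖w‖ ≤ 1 →
    FluidDecaying h η α t (pd v (pd w (WaterWave.pot φ)))

theorem IsSolution.exists_decay {g h t : ℝ} {I : Set ℝ} {η : ℝ → ℝ → ℝ} {φ : ℝ → ℝ → ℝ → ℝ}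
    (hsol : IsSolution g h I η φ) (hI : IsOpen I) (ht : t ∈ I) :
    ∃ α, SolutionDecay h η φ α t := by
  obtain ⟨C, α, hα, hC⟩ := hsol.decay t ht
  have hline : ∀ s x : ℝ, ContinuousAt (fun y : ℝ => (s, y)) x := fun s x => by fun_prop
  have h10 : ‖((1 : ℝ), (0 : ℝ))‖ ≤ 1 := by simp [Prod.norm_def]
  have h01 : ‖((0 : ℝ), (1 : ℝ))‖ ≤ 1 := by simp [Prod.norm_def]
  have hpdelev : ∀ v : ℝ × ℝ, ‖v‖ ≤ 1 →
      Decaying α t fun s x => pd v (WaterWave.elev η) (s, x) := by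
    intro v hv
    refine ⟨?_, C, ?_⟩
    · filter_upwards [hI.mem_nhds ht] with s hs
      refine continuous_iff_continuousAt.2 fun x => ?_
      exact ContinuousAt.comp (f := fun y => (s, y)) (contDiffAt_pd (m := 2)
        (hsol.contDiffAt_elev hs x) le_rfl).continuousAt (hline s x)
    · filter_upwards [hC] with s hs x
      exact (abs_pd_le hv).trans (hs 1 (by norm_num) x).1
  refine ⟨α, hα, ⟨?_, C, ?_⟩, ?_, ?_, ⟨?_, C, ?_⟩, ⟨C, ?_⟩, fun v hv => ⟨C, ?_⟩,
    fun v w hv hw => ⟨C, ?_⟩⟩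
  · filter_upwards [hI.mem_nhds ht] with s hs using hsol.continuous_elev hs
  · filter_upwards [hC] with s hs x
    simpa using (hs 0 (by norm_num) x).1
  · refine (hpdelev _ h10).congr ?_
    filter_upwards [hI.mem_nhds ht] with s hs x using hsol.surfaceSpeed_eq hs x
  · refine (hpdelev _ h01).congr ?_
    filter_upwards [hI.mem_nhds ht] with s hs x using hsol.slope_eq hs x
  · filter_upwards [hI.mem_nhds ht] with s hs
    refine continuous_iff_continuousAt.2 fun x => ?_
    exact ContinuousAt.comp (f := fun y => (s, y)) (contDiffAt_pd (m := 1)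
      (contDiffAt_pd (m := 2) (hsol.contDiffAt_elev hs x) le_rfl) le_rfl).continuousAt
      (hline s x)
  · filter_upwards [hC, hI.mem_nhds ht] with s hs hsI x
    exact (abs_pd_pd_le ((hsol.contDiffAt_elev hsI x).of_le (by norm_num)) h10 h01).trans
      (hs 2 le_rfl x).1
  · filter_upwards [hC, hI.mem_nhds ht] with s hs hsI x z hz hz'
    refine ⟨(hsol.contDiffAt_pot hsI hz hz').continuousAt, ?_⟩
    simpa [WaterWave.pot] using (hs 0 (by norm_num) x).2 z hz hz'
  · filter_upwards [hC, hI.mem_nhds ht] with s hs hsI x z hz hz'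
    exact ⟨(hsol.contDiffAt_pd_pot hsI hz hz' v).continuousAt,
      (abs_pd_le hv).trans ((hs 1 (by norm_num) x).2 z hz hz')⟩
  · filter_upwards [hC, hI.mem_nhds ht] with s hs hsI x z hz hz'
    exact ⟨(hsol.contDiffAt_pd_pd_pot hsI hz hz' v w).continuousAt,
      (abs_pd_pd_le ((hsol.contDiffAt_pot hsI hz hz').of_le (by norm_num)) hv hw).trans
        ((hs 2 le_rfl x).2 z hz hz')⟩

/-! ### Decay of products on the surface and in the fluid. -/

theorem Decaying.sq {α t : ℝ} {f : ℝ → ℝ → ℝ} (hα : 0 ≤ α) (hf : Decaying α t f) :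
    Decaying α t fun s x => f s x ^ 2 := by
  simpa only [pow_two] using hf.mul hα hf

theorem isBigO_mul_weight {α : ℝ} (hα : 0 ≤ α) {l : Filter (ℝ × ℝ)} {F G : ℝ × ℝ → ℝ}
    (hF : F =O[l] fun p => (1 + |p.1|) ^ (-α)) (hG : G =O[l] fun p => (1 + |p.1|) ^ (-α)) :
    (fun p => F p * G p) =O[l] fun p => (1 + |p.1|) ^ (-α) := by
  refine (hF.mul hG).trans (Asymptotics.IsBigO.of_bound 1 (Eventually.of_forall fun p => ?_))
  have h0 := weight_nonneg α p.1
  rw [Real.norm_of_nonneg h0, Real.norm_of_nonneg (mul_nonneg h0 h0), one_mul]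
  exact mul_le_of_le_one_right h0 (weight_le_one hα p.1)

theorem isBigO_fst_mul {α : ℝ} (hα : 1 ≤ α) {l : Filter (ℝ × ℝ)} {F : ℝ × ℝ → ℝ}
    (hF : F =O[l] fun p => (1 + |p.1|) ^ (-α)) :
    (fun p => p.1 * F p) =O[l] fun _ => (1 : ℝ) := by
  refine ((Asymptotics.isBigO_refl (fun p : ℝ × ℝ => p.1) l).mul hF).trans
    (Asymptotics.IsBigO.of_bound 1 (Eventually.of_forall fun p => ?_))
  rw [norm_mul, Real.norm_of_nonneg (weight_nonneg α p.1)]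
  simpa using abs_mul_weight_le_one hα p.1

theorem isBigO_one_mul_weight {α : ℝ} {l : Filter (ℝ × ℝ)} {F G : ℝ × ℝ → ℝ}
    (hF : F =O[l] fun _ => (1 : ℝ)) (hG : G =O[l] fun p => (1 + |p.1|) ^ (-α)) :
    (fun p => F p * G p) =O[l] fun p => (1 + |p.1|) ^ (-α) := by
  simpa using hF.mul hG

theorem contDiffAt_slice {F : ℝ × ℝ × ℝ → ℝ} {t x z : ℝ} (hF : ContDiffAt ℝ 1 F (t, x, z)) :
    ContDiffAt ℝ 1 (fun p : ℝ × ℝ => F (t, p.1, p.2)) (x, z) :=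
  ContDiffAt.comp (f := fun p : ℝ × ℝ => (t, p.1, p.2)) (x, z) hF (by fun_prop)

/-! ### Fluxes through the fluid and rates of change of the moments. -/

section laws

variable {g h t α : ℝ} {I : Set ℝ} {η : ℝ → ℝ → ℝ} {φ : ℝ → ℝ → ℝ → ℝ}

theorem SolutionDecay.surf_pot (hd : SolutionDecay h η φ α t) (hsol : IsSolution g h I η φ)
    (hI : IsOpen I) (ht : t ∈ I) : Decaying α t (surf η (WaterWave.pot φ)) :=
  hsol.decaying_surf hI ht hd.pot

theorem SolutionDecay.surf_pd (hd : SolutionDecay h η φ α t) (hsol : IsSolution g h I η φ)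
    (hI : IsOpen I) (ht : t ∈ I) {v : ℝ × ℝ × ℝ} (hv : ‖v‖ ≤ 1) :
    Decaying α t (surf η (pd v (WaterWave.pot φ))) :=
  hsol.decaying_surf hI ht (hd.pd_pot v hv)

theorem SolutionDecay.surf_pd_pd (hd : SolutionDecay h η φ α t) (hsol : IsSolution g h I η φ)
    (hI : IsOpen I) (ht : t ∈ I) {v w : ℝ × ℝ × ℝ} (hv : ‖v‖ ≤ 1) (hw : ‖w‖ ≤ 1) :
    Decaying α t (surf η (pd v (pd w (WaterWave.pot φ)))) :=
  hsol.decaying_surf hI ht (hd.pd_pd_pot v w hv hw)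

theorem SolutionDecay.bot_pd (hd : SolutionDecay h η φ α t) (hsol : IsSolution g h I η φ)
    (hI : IsOpen I) (ht : t ∈ I) {v : ℝ × ℝ × ℝ} (hv : ‖v‖ ≤ 1) :
    Decaying α t (bot h (pd v (WaterWave.pot φ))) :=
  hsol.decaying_bot hI ht (hd.pd_pot v hv)

/-- The elevation is bounded, hence so is z in the fluid; fields carrying a factor z still decay. -/
theorem SolutionDecay.isBigO_depth (hd : SolutionDecay h η φ α t) :
    (fun p : ℝ × ℝ => p.2) =O[𝓟 (fluid h η t)] fun _ => (1 : ℝ) := by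
  obtain ⟨K, hK⟩ := hd.elev.exists_abs_le (by linarith [hd.one_lt])
  refine Asymptotics.IsBigO.of_bound (K + |h|) ?_
  rw [eventually_principal]
  intro p hp
  have h1 := hK p.1
  have h2 := le_abs_self (η t p.1)
  have h3 := neg_abs_le h
  have h4 := le_abs_self h
  have h5 := abs_nonneg (η t p.1)
  have h6 := abs_nonneg h
  rw [norm_one, mul_one, Real.norm_eq_abs, abs_le]
  exact ⟨by linarith [hp.1], by linarith [hp.2]⟩

/-- The flux of a divergence-free field through the surface equals that through the bottom. -/
theorem IsSolution.flux (hsol : IsSolution g h I η φ) (ht : t ∈ I)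
    (hd : SolutionDecay h η φ α t) {F G : ℝ → ℝ → ℝ}
    (hF : ∀ x z, -h ≤ z → z ≤ η t x → ContDiffAt ℝ 1 (fun p : ℝ × ℝ => F p.1 p.2) (x, z))
    (hG : ∀ x z, -h ≤ z → z ≤ η t x → ContDiffAt ℝ 1 (fun p : ℝ × ℝ => G p.1 p.2) (x, z))
    (hdiv : ∀ x z, -h < z → z < η t x →
      ∃ a, HasDerivAt (fun y => F y z) a x ∧ HasDerivAt (fun w => G x w) (-a) z)
    (hO : (fun p : ℝ × ℝ => F p.1 p.2) =O[𝓟 (fluid h η t)] fun p => (1 + |p.1|) ^ (-α))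
    (hsurf : Integrable fun x => G x (η t x) - slope η t x * F x (η t x))
    (hbot : Integrable fun x => G x (-h)) :
    ∫ x, (G x (η t x) - slope η t x * F x (η t x)) = ∫ x, G x (-h) := by
  have hα := hd.one_lt
  obtain ⟨K, hK⟩ := hd.elev.exists_abs_le (by linarith)
  obtain ⟨C, hC⟩ := hO.bound
  rw [eventually_principal] at hC
  refine flux_surface_eq_flux_bottom (C := C) (by linarith : 0 < α) (hsol.hasDerivAt_slope ht)
    (hsol.above_bottom t ht) hK hF (fun x z hz hz' => (hG x z hz hz').continuousAt) hdiv ?_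
    hsurf hbot
  intro x z hz hz'
  have := hC (x, z) ⟨hz, hz'⟩
  rwa [Real.norm_of_nonneg (weight_nonneg α x)] at this

theorem hasDerivAt_slice_x {F : ℝ × ℝ × ℝ → ℝ} {x z : ℝ}
    (hF : DifferentiableAt ℝ F (t, x, z)) :
    HasDerivAt (fun y => F (t, y, z)) (pd eX F (t, x, z)) x :=
  hasDerivAt_comp_pd (c := fun y => (t, y, z)) hF (hasDerivAt_line_x t x z)

theorem hasDerivAt_slice_z {F : ℝ × ℝ × ℝ → ℝ} {x z : ℝ}
    (hF : DifferentiableAt ℝ F (t, x, z)) :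
    HasDerivAt (fun w => F (t, x, w)) (pd eZ F (t, x, z)) z :=
  hasDerivAt_comp_pd (c := fun w => (t, x, w)) hF (hasDerivAt_line_z t x z)

/-- Conservation of mass. -/
theorem IsSolution.hasDerivAt_mass (hsol : IsSolution g h I η φ) (hI : IsOpen I) (ht : t ∈ I)
    (hd : SolutionDecay h η φ α t) : HasDerivAt (fun s => ∫ x, η s x) 0 t := by
  have hα := hd.one_lt
  have hder := hd.elev.hasDerivAt_integral hα hd.speed <| by
    filter_upwards [hI.mem_nhds ht] with s hs x using hsol.hasDerivAt_surfaceSpeed hs x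
  refine hder.congr_deriv ?_
  -- The kinematic condition says that η_t is the flux density of ∇φ through the surface.
  have hpt : ∀ x, pd eZ (pot φ) (t, x, η t x) - slope η t x * pd eX (pot φ) (t, x, η t x)
      = surfaceSpeed η t x := fun x => by
    rw [hsol.kinematic_surf ht]
    simp only [surf]
    ring
  have hflux := hsol.flux ht hd (F := fun x z => pd eX (pot φ) (t, x, z))
    (G := fun x z => pd eZ (pot φ) (t, x, z))
    (fun x z hz hz' => contDiffAt_slice ((hsol.contDiffAt_pd_pot ht hz hz' eX).of_le (by norm_num)))
    (fun x z hz hz' => contDiffAt_slice ((hsol.contDiffAt_pd_pot ht hz hz' eZ).of_le (by norm_num)))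
    (fun x z hz hz' => ⟨_, hasDerivAt_slice_x (hsol.differentiableAt_pd_pot ht hz.le hz'.le eX),
      (hasDerivAt_slice_z (hsol.differentiableAt_pd_pot ht hz.le hz'.le eZ)).congr_deriv
        (by linarith [hsol.laplace_pd ht hz hz'])⟩)
    (hd.pd_pot eX norm_eX).isBigO
    (by simpa only [hpt] using hd.speed.integrable hα)
    ((hd.bot_pd hsol hI ht norm_eZ).integrable hα)
  simp only [hpt] at hflux
  rw [hflux]
  exact integral_eq_zero_of_ae (Eventually.of_forall fun x => hsol.bot_pd_eZ ht x)

/-- The rate of change of the impulse `∫ q`. -/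
theorem IsSolution.hasDerivAt_impulse (hsol : IsSolution g h I η φ) (hI : IsOpen I) (ht : t ∈ I)
    (hd : SolutionDecay h η φ α t) :
    HasDerivAt (fun s => ∫ x, surf η (pot φ) s x)
      (-g * (∫ x, η t x) - 1 / 2 * ∫ x, bot h (pd eX (pot φ)) t x ^ 2) t := by
  have hα := hd.one_lt
  have hα0 : 0 ≤ α := by linarith
  have hu := hd.surf_pd hsol hI ht norm_eX
  have hw := hd.surf_pd hsol hI ht norm_eZ
  have hder := (hd.surf_pot hsol hI ht).hasDerivAt_integral hα
    ((hd.surf_pd hsol hI ht norm_eT).add (hw.mul hα0 hd.speed)) <| by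
    filter_upwards [hI.mem_nhds ht] with s hs x using hsol.hasDerivAt_surf_t hs
      (hsol.differentiableAt_pot hs (hsol.above_bottom s hs x).le le_rfl)
  refine hder.congr_deriv ?_
  -- On the surface q_t + gη = (φ_z² - φ_x²)/2 - η_x φ_x φ_z, by both boundary conditions. This is
  -- the flux density of the field below.
  have hflux := hsol.flux ht hd
    (F := fun x z => pd eX (pot φ) (t, x, z) * pd eZ (pot φ) (t, x, z))
    (G := fun x z => (pd eZ (pot φ) (t, x, z) ^ 2 - pd eX (pot φ) (t, x, z) ^ 2) / 2)
    (fun x z hz hz' =>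
      (contDiffAt_slice ((hsol.contDiffAt_pd_pot ht hz hz' eX).of_le (by norm_num))).mul
        (contDiffAt_slice ((hsol.contDiffAt_pd_pot ht hz hz' eZ).of_le (by norm_num))))
    (fun x z hz hz' =>
      (((contDiffAt_slice ((hsol.contDiffAt_pd_pot ht hz hz' eZ).of_le (by norm_num))).pow 2).sub
        ((contDiffAt_slice ((hsol.contDiffAt_pd_pot ht hz hz' eX).of_le (by norm_num))).pow 2)).div_const
        2)
    (fun x z hz hz' => by
      have dX := hsol.differentiableAt_pd_pot ht hz.le hz'.le eX
      have dZ := hsol.differentiableAt_pd_pot ht hz.le hz'.le eZ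
      refine ⟨_, (hasDerivAt_slice_x dX).mul (hasDerivAt_slice_x dZ),
        ((((hasDerivAt_slice_z dZ).pow 2).sub ((hasDerivAt_slice_z dX).pow 2)).div_const
          2).congr_deriv ?_⟩
      rw [hsol.pd_comm_pot ht hz.le hz'.le eZ eX]
      simp only [Nat.cast_ofNat, Nat.add_one_sub_one, pow_one]
      linear_combination pd eZ (pot φ) (t, x, z) * hsol.laplace_pd ht hz hz')
    (isBigO_mul_weight hα0 (hd.pd_pot eX norm_eX).isBigO (hd.pd_pot eZ norm_eZ).isBigO)
    (((((hw.sq hα0).sub (hu.sq hα0)).div_const 2).sub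
      (hd.slope.mul hα0 (hu.mul hα0 hw))).integrable hα)
    (((((hd.bot_pd hsol hI ht norm_eZ).sq hα0).sub
      ((hd.bot_pd hsol hI ht norm_eX).sq hα0)).div_const 2).integrable hα)
  have hbot : ∫ x, (pd eZ (pot φ) (t, x, -h) ^ 2 - pd eX (pot φ) (t, x, -h) ^ 2) / 2
      = -(1 / 2 * ∫ x, bot h (pd eX (pot φ)) t x ^ 2) := by
    rw [← neg_mul, ← integral_const_mul]
    refine integral_congr_ae (Eventually.of_forall fun x => ?_)
    have := hsol.bot_pd_eZ ht x
    simp only [bot] at this ⊢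
    rw [this]
    ring
  rw [hbot] at hflux
  rw [sub_eq_add_neg, ← hflux, ← integral_const_mul, ← integral_add]
  · refine integral_congr_ae (Eventually.of_forall fun x => ?_)
    simp only []
    rw [hsol.dynamic_surf ht, hsol.kinematic_surf ht]
    simp only [surf]
    ring
  · exact (hd.elev.const_mul (-g)).integrable hα
  · exact ((((hw.sq hα0).sub (hu.sq hα0)).div_const 2).sub
      (hd.slope.mul hα0 (hu.mul hα0 hw))).integrable hα

end laws

/-- This pattern of signs occurs both in the rate of the scaling density and in the contour
integral. -/
theorem integral_combination {a b c d e : ℝ → ℝ} (ha : Integrable a) (hb : Integrable b)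
    (hc : Integrable c) (hd : Integrable d) (he : Integrable e) :
    ∫ x, (a x - b x + c x - d x + e x)
      = (∫ x, a x) - (∫ x, b x) + (∫ x, c x) - (∫ x, d x) + ∫ x, e x := by
  rw [integral_add (f := fun x => a x - b x + c x - d x) (((ha.sub hb).add hc).sub hd) he,
    integral_sub (f := fun x => a x - b x + c x) ((ha.sub hb).add hc) hd,
    integral_add (f := fun x => a x - b x) (ha.sub hb) hc, integral_sub ha hb]

section laws

variable {g h t α : ℝ} {I : Set ℝ} {η : ℝ → ℝ → ℝ} {φ : ℝ → ℝ → ℝ → ℝ}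

/-- The rate of change of the potential energy `∫ η²`. -/
theorem IsSolution.hasDerivAt_integral_elev_sq (hsol : IsSolution g h I η φ) (hI : IsOpen I)
    (ht : t ∈ I) (hd : SolutionDecay h η φ α t) :
    HasDerivAt (fun s => ∫ x, η s x ^ 2)
      (2 * (∫ x, surf η (pot φ) t x) - 2 * ∫ x, bot h (pot φ) t x) t := by
  have hα := hd.one_lt
  have hα0 : 0 ≤ α := by linarith
  have hq := hd.surf_pot hsol hI ht
  have hb := hsol.decaying_bot hI ht hd.pot
  have hw := hd.surf_pd hsol hI ht norm_eZ
  have hder := (hd.elev.sq hα0).hasDerivAt_integral hα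
    ((hd.elev.mul hα0 hd.speed).const_mul 2) <| by
    filter_upwards [hI.mem_nhds ht] with s hs x
    refine ((hsol.hasDerivAt_surfaceSpeed hs x).pow 2).congr_deriv ?_
    simp only [Nat.cast_ofNat, Nat.add_one_sub_one, pow_one]
    ring
  refine hder.congr_deriv ?_
  have hpt : ∀ x, (η t x * pd eZ (pot φ) (t, x, η t x) - pot φ (t, x, η t x))
      - slope η t x * (η t x * pd eX (pot φ) (t, x, η t x))
      = η t x * surfaceSpeed η t x - surf η (pot φ) t x := fun x => by
    rw [hsol.kinematic_surf ht]
    simp only [surf]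
    ring
  have hpb : ∀ x, -h * pd eZ (pot φ) (t, x, -h) - pot φ (t, x, -h) = -bot h (pot φ) t x :=
    fun x => by
      have := hsol.bot_pd_eZ ht x
      simp only [bot] at this ⊢
      rw [this]
      ring
  have hsurf := ((hd.elev.mul hα0 hd.speed).sub hq).integrable hα
  -- Green's second identity for the harmonic functions z and φ: the surface flux density is ηη_t -
  -- q, the bottom one -φ.
  have hflux := hsol.flux ht hd
    (F := fun x z => z * pd eX (pot φ) (t, x, z))
    (G := fun x z => z * pd eZ (pot φ) (t, x, z) - pot φ (t, x, z))
    (fun x z hz hz' => contDiffAt_snd.mul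
        (contDiffAt_slice ((hsol.contDiffAt_pd_pot ht hz hz' eX).of_le (by norm_num))))
    (fun x z hz hz' => (contDiffAt_snd.mul
        (contDiffAt_slice ((hsol.contDiffAt_pd_pot ht hz hz' eZ).of_le (by norm_num)))).sub
        (contDiffAt_slice ((hsol.contDiffAt_pot ht hz hz').of_le (by norm_num))))
    (fun x z hz hz' => by
      have d0 := hsol.differentiableAt_pot ht hz.le hz'.le
      have dX := hsol.differentiableAt_pd_pot ht hz.le hz'.le eX
      have dZ := hsol.differentiableAt_pd_pot ht hz.le hz'.le eZ
      refine ⟨_, (hasDerivAt_slice_x dX).const_mul z,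
        (((hasDerivAt_id' z).mul (hasDerivAt_slice_z dZ)).sub
          (hasDerivAt_slice_z d0)).congr_deriv ?_⟩
      linear_combination z * hsol.laplace_pd ht hz hz')
    (isBigO_one_mul_weight hd.isBigO_depth (hd.pd_pot eX norm_eX).isBigO)
    (by simpa only [hpt] using hsurf)
    (by simpa only [hpb] using hb.neg.integrable hα)
  simp only [hpt, hpb] at hflux
  rw [integral_neg, integral_sub ((hd.elev.mul hα0 hd.speed).integrable hα)
    (hq.integrable hα)] at hflux
  rw [integral_const_mul]
  linarith

/-- The energy density in terms of traces on the surface. -/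
theorem IsSolution.alongSurface_ham (hsol : IsSolution g h I η φ) (ht : t ∈ I) (x : ℝ) :
    alongSurface η t (hamP g φ t) (hamQ φ t) x
      = (surf η (pot φ) t x * (surf η (pd eZ (pot φ)) t x
        - surf η (pd eX (pot φ)) t x * slope η t x) + g * η t x ^ 2) / 2 := by
  have ha := (hsol.above_bottom t ht x).le
  simp only [alongSurface, hamP, hamQ, hsol.dz_eq ht ha le_rfl, hsol.dx_eq ht ha le_rfl, surf,
    pot]
  ring

/-- Laplace's equation is assumed only inside the fluid; it extends to the surface from below by
continuity of the second derivatives. -/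
theorem IsSolution.laplace_surf (hsol : IsSolution g h I η φ) (ht : t ∈ I) (x : ℝ) :
    surf η (pd eX (pd eX (pot φ))) t x + surf η (pd eZ (pd eZ (pot φ))) t x = 0 := by
  have ha := hsol.above_bottom t ht x
  have hc : ContinuousAt (fun z => pd eX (pd eX (pot φ)) (t, x, z)
      + pd eZ (pd eZ (pot φ)) (t, x, z)) (η t x) := by
    have h1 : ∀ v, ContinuousAt (fun z => pd v (pd v (pot φ)) (t, x, z)) (η t x) := fun v =>
      ContinuousAt.comp (f := fun z => (t, x, z))
        (hsol.contDiffAt_pd_pd_pot ht ha.le le_rfl v v).continuousAt (by fun_prop)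
    exact (h1 eX).add (h1 eZ)
  have h0 : (fun z => pd eX (pd eX (pot φ)) (t, x, z) + pd eZ (pd eZ (pot φ)) (t, x, z))
      =ᶠ[𝓝[<] (η t x)] fun _ => 0 := by
    filter_upwards [Ioo_mem_nhdsLT ha] with z hz using hsol.laplace_pd ht hz.1 hz.2
  exact tendsto_nhds_unique (hc.tendsto.mono_left nhdsWithin_le_nhds)
    (tendsto_const_nhds.congr' h0.symm)

/-- Conservation of energy. -/
theorem IsSolution.hasDerivAt_hamiltonian (hsol : IsSolution g h I η φ) (hI : IsOpen I)
    (ht : t ∈ I) (hd : SolutionDecay h η φ α t) : HasDerivAt (hamiltonian g η φ) 0 t := by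
  have hα := hd.one_lt
  have hα0 : 0 ≤ α := by linarith
  have hq := hd.surf_pot hsol hI ht
  have ha := hd.surf_pd hsol hI ht norm_eT
  have hu := hd.surf_pd hsol hI ht norm_eX
  have hw := hd.surf_pd hsol hI ht norm_eZ
  have hpd : ∀ {v w}, ‖v‖ ≤ 1 → ‖w‖ ≤ 1 → Decaying α t (surf η (pd v (pd w (pot φ)))) :=
    fun hv hw => hd.surf_pd_pd hsol hI ht hv hw
  have hder := (((hq.mul hα0 (hw.sub (hu.mul hα0 hd.slope))).add
    ((hd.elev.sq hα0).const_mul g)).div_const 2).hasDerivAt_integral hα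
    (((((ha.add (hw.mul hα0 hd.speed)).mul hα0 (hw.sub (hu.mul hα0 hd.slope))).add
      (hq.mul hα0 (((hpd norm_eT norm_eZ).add ((hpd norm_eZ norm_eZ).mul hα0 hd.speed)).sub
        ((((hpd norm_eT norm_eX).add ((hpd norm_eZ norm_eX).mul hα0 hd.speed)).mul hα0
          hd.slope).add (hu.mul hα0 hd.slopeRate))))).add
      (((hd.elev.mul hα0 hd.speed).const_mul 2).const_mul g)).div_const 2) <| by
    filter_upwards [hI.mem_nhds ht] with s hs x
    have hb := (hsol.above_bottom s hs x).le
    have d0 := hsol.hasDerivAt_surf_t hs (hsol.differentiableAt_pot hs hb le_rfl)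
    have dX := hsol.hasDerivAt_surf_t hs (hsol.differentiableAt_pd_pot hs hb le_rfl eX)
    have dZ := hsol.hasDerivAt_surf_t hs (hsol.differentiableAt_pd_pot hs hb le_rfl eZ)
    refine (((d0.mul (dZ.sub (dX.mul (hsol.hasDerivAt_slope_t hI hs x)))).add
      (((hsol.hasDerivAt_surfaceSpeed hs x).pow 2).const_mul g)).div_const 2).congr_deriv ?_
    simp only [Nat.cast_ofNat, Nat.add_one_sub_one, pow_one, Pi.sub_apply, Pi.mul_apply]
    ring
  have hev : hamiltonian g η φ =ᶠ[𝓝 t] fun s => ∫ x, (surf η (pot φ) s x *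
      (surf η (pd eZ (pot φ)) s x - surf η (pd eX (pot φ)) s x * slope η s x)
        + g * η s x ^ 2) / 2 := by
    filter_upwards [hI.mem_nhds ht] with s hs
    exact integral_congr_ae (Eventually.of_forall fun x => hsol.alongSurface_ham hs x)
  refine (hder.congr_of_eventuallyEq hev).congr_deriv ?_
  have hsurf := (((hq.mul hα0 (hpd norm_eZ norm_eT)).sub (ha.mul hα0 hw)).sub
    (hd.slope.mul hα0 ((hq.mul hα0 (hpd norm_eX norm_eT)).sub (ha.mul hα0 hu)))).integrable hα
  have hpb : ∀ x, pot φ (t, x, -h) * pd eZ (pd eT (pot φ)) (t, x, -h)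
      - pd eT (pot φ) (t, x, -h) * pd eZ (pot φ) (t, x, -h) = 0 := fun x => by
    have h1 := hsol.bot_pd_eZ ht x
    have h2 := hsol.bot_pd_eZ_eT hI ht x
    simp only [bot] at h1 h2
    rw [h1, h2]
    ring
  -- Green's second identity for φ and φ_t: both normal derivatives vanish on the bottom, so the
  -- total flux through the surface is zero.
  have hflux := hsol.flux ht hd
    (F := fun x z => pot φ (t, x, z) * pd eX (pd eT (pot φ)) (t, x, z)
      - pd eT (pot φ) (t, x, z) * pd eX (pot φ) (t, x, z))
    (G := fun x z => pot φ (t, x, z) * pd eZ (pd eT (pot φ)) (t, x, z)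
      - pd eT (pot φ) (t, x, z) * pd eZ (pot φ) (t, x, z))
    (fun x z hz hz' =>
      ((contDiffAt_slice ((hsol.contDiffAt_pot ht hz hz').of_le (by norm_num))).mul
        (contDiffAt_slice (hsol.contDiffAt_pd_pd_pot ht hz hz' eX eT))).sub
      ((contDiffAt_slice ((hsol.contDiffAt_pd_pot ht hz hz' eT).of_le (by norm_num))).mul
        (contDiffAt_slice ((hsol.contDiffAt_pd_pot ht hz hz' eX).of_le (by norm_num)))))
    (fun x z hz hz' =>
      ((contDiffAt_slice ((hsol.contDiffAt_pot ht hz hz').of_le (by norm_num))).mul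
        (contDiffAt_slice (hsol.contDiffAt_pd_pd_pot ht hz hz' eZ eT))).sub
      ((contDiffAt_slice ((hsol.contDiffAt_pd_pot ht hz hz' eT).of_le (by norm_num))).mul
        (contDiffAt_slice ((hsol.contDiffAt_pd_pot ht hz hz' eZ).of_le (by norm_num)))))
    (fun x z hz hz' => by
      have d0 := hsol.differentiableAt_pot ht hz.le hz'.le
      have d1 := hsol.differentiableAt_pd_pot ht hz.le hz'.le
      have d2 : ∀ v, DifferentiableAt ℝ (pd v (pd eT (pot φ))) (t, x, z) := fun v =>
        (hsol.contDiffAt_pd_pd_pot ht hz.le hz'.le v eT).differentiableAt (by simp)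
      refine ⟨_, ((hasDerivAt_slice_x d0).mul (hasDerivAt_slice_x (d2 eX))).sub
        ((hasDerivAt_slice_x (d1 eT)).mul (hasDerivAt_slice_x (d1 eX))),
        (((hasDerivAt_slice_z d0).mul (hasDerivAt_slice_z (d2 eZ))).sub
        ((hasDerivAt_slice_z (d1 eT)).mul (hasDerivAt_slice_z (d1 eZ)))).congr_deriv ?_⟩
      linear_combination pot φ (t, x, z) * hsol.laplace_pd_eT hI ht hz hz'
        - pd eT (pot φ) (t, x, z) * hsol.laplace_pd ht hz hz')
    ((isBigO_mul_weight hα0 hd.pot.isBigO (hd.pd_pd_pot eX eT norm_eX norm_eT).isBigO).sub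
      (isBigO_mul_weight hα0 (hd.pd_pot eT norm_eT).isBigO (hd.pd_pot eX norm_eX).isBigO))
    hsurf
    (by simp only [hpb]; exact integrable_zero _ _ _)
  simp only [hpb, integral_zero] at hflux
  -- The correction is exact: it is the x-derivative of q η_t φ_x along the surface, whose integral
  -- vanishes.
  have hdiff := ((hq.mul hα0 hd.speed).mul hα0 hu)
  have hdiff' := ((((hu.add (hw.mul hα0 hd.slope)).mul hα0 hd.speed).add
    (hq.mul hα0 hd.slopeRate)).mul hα0 hu).add ((hq.mul hα0 hd.speed).mul hα0
      ((hpd norm_eX norm_eX).add ((hpd norm_eZ norm_eX).mul hα0 hd.slope)))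
  have hzero := hdiff.integral_eq_zero_of_hasDerivAt hα hdiff' fun x => by
    have hb := (hsol.above_bottom t ht x).le
    have d0 := hsol.hasDerivAt_surf_x ht (hsol.differentiableAt_pot ht hb le_rfl)
    have dX := hsol.hasDerivAt_surf_x ht (hsol.differentiableAt_pd_pot ht hb le_rfl eX)
    exact (d0.mul (hsol.hasDerivAt_surfaceSpeed_x ht x)).mul dX
  have hsub := integral_sub hsurf (hdiff'.integrable hα)
  rw [hzero, sub_zero] at hsub
  replace hsub := hsub.trans hflux
  -- Pointwise, twice the time derivative of the energy density is the Green flux minus the exact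
  -- term. The boundary conditions eliminate φ_t and η_t, and Laplace's equation on the surface
  -- exchanges φ_zz for -φ_xx.
  rw [← mul_zero (1 / 2 : ℝ), ← hsub, ← integral_const_mul]
  refine integral_congr_ae (Eventually.of_forall fun x => ?_)
  have hb := (hsol.above_bottom t ht x).le
  have hlap := hsol.laplace_surf ht x
  have hkin := hsol.kinematic_surf ht x
  have hdyn := hsol.dynamic_surf ht x
  have hTZ := hsol.pd_comm_pot ht hb le_rfl eT eZ
  have hTX := hsol.pd_comm_pot ht hb le_rfl eT eX
  simp only [surf] at hlap hkin hdyn hTZ hTX ⊢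
  rw [hTZ, hTX, hdyn, hkin]
  linear_combination (1 / 2) * pot φ (t, x, η t x) * (pd eZ (pot φ) (t, x, η t x)
    - pd eX (pot φ) (t, x, η t x) * slope η t x) * hlap

/-- The rate of change of the integral of the scaling density `q (η - x η_x)`. -/
theorem IsSolution.hasDerivAt_scaling (hsol : IsSolution g h I η φ) (hI : IsOpen I)
    (ht : t ∈ I) (hd : SolutionDecay h η φ α t) :
    HasDerivAt (fun s => ∫ x, (surf η (pot φ) s x * η s x
        - x * surf η (pot φ) s x * slope η s x))
      (4 * hamiltonian g η φ t - 7 / 2 * g * (∫ x, η t x ^ 2)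
        + h / 2 * ∫ x, bot h (pd eX (pot φ)) t x ^ 2) t := by
  have hα := hd.one_lt
  have hα0 : 0 ≤ α := by linarith
  have hq := hd.surf_pot hsol hI ht
  have ha := hd.surf_pd hsol hI ht norm_eT
  have hu := hd.surf_pd hsol hI ht norm_eX
  have hw := hd.surf_pd hsol hI ht norm_eZ
  have hqt := ha.add (hw.mul hα0 hd.speed)
  have hder := ((hq.mul hα0 hd.elev).sub (hq.id_mul_mul hα.le hd.slope)).hasDerivAt_integral hα
    (((hqt.mul hα0 hd.elev).add (hq.mul hα0 hd.speed)).sub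
      ((hqt.id_mul_mul hα.le hd.slope).add (hq.id_mul_mul hα.le hd.slopeRate))) <| by
    filter_upwards [hI.mem_nhds ht] with s hs x
    have hb := (hsol.above_bottom s hs x).le
    have d0 := hsol.hasDerivAt_surf_t hs (hsol.differentiableAt_pot hs hb le_rfl)
    exact (d0.mul (hsol.hasDerivAt_surfaceSpeed hs x)).sub
      ((d0.const_mul x).mul (hsol.hasDerivAt_slope_t hI hs x))
  refine hder.congr_deriv ?_
  have hsurf := (((hd.elev.mul hα0 (((hw.sq hα0).sub (hu.sq hα0)).div_const 2)).add
    (hu.id_mul_mul hα.le hw)).sub (hd.slope.mul hα0 ((hd.elev.mul hα0 (hu.mul hα0 hw)).add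
      (((hu.id_mul_mul hα.le hu).sub (hw.id_mul_mul hα.le hw)).div_const 2)))).integrable hα
  have hpb : ∀ x, -h * ((pd eZ (pot φ) (t, x, -h) ^ 2 - pd eX (pot φ) (t, x, -h) ^ 2) / 2)
      + x * pd eX (pot φ) (t, x, -h) * pd eZ (pot φ) (t, x, -h)
      = h / 2 * bot h (pd eX (pot φ)) t x ^ 2 := fun x => by
    have h1 := hsol.bot_pd_eZ ht x
    simp only [bot] at h1 ⊢
    rw [h1]
    ring
  -- The components are the real part and minus the imaginary part of ½(x + iz)(φ_x - iφ_z)². On the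
  -- bottom only (h/2)φ_x² survives.
  have hflux := hsol.flux ht hd
    (F := fun x z => z * (pd eX (pot φ) (t, x, z) * pd eZ (pot φ) (t, x, z))
      + (x * pd eX (pot φ) (t, x, z) * pd eX (pot φ) (t, x, z)
        - x * pd eZ (pot φ) (t, x, z) * pd eZ (pot φ) (t, x, z)) / 2)
    (G := fun x z => z * ((pd eZ (pot φ) (t, x, z) ^ 2 - pd eX (pot φ) (t, x, z) ^ 2) / 2)
      + x * pd eX (pot φ) (t, x, z) * pd eZ (pot φ) (t, x, z))
    (fun x z hz hz' => by
      have c : ∀ v, ContDiffAt ℝ 1 (fun p : ℝ × ℝ => pd v (pot φ) (t, p.1, p.2)) (x, z) :=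
        fun v => contDiffAt_slice ((hsol.contDiffAt_pd_pot ht hz hz' v).of_le (by norm_num))
      exact (contDiffAt_snd.mul ((c eX).mul (c eZ))).add
        ((((contDiffAt_fst.mul (c eX)).mul (c eX)).sub
          ((contDiffAt_fst.mul (c eZ)).mul (c eZ))).div_const 2))
    (fun x z hz hz' => by
      have c : ∀ v, ContDiffAt ℝ 1 (fun p : ℝ × ℝ => pd v (pot φ) (t, p.1, p.2)) (x, z) :=
        fun v => contDiffAt_slice ((hsol.contDiffAt_pd_pot ht hz hz' v).of_le (by norm_num))
      exact (contDiffAt_snd.mul ((((c eZ).pow 2).sub ((c eX).pow 2)).div_const 2)).add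
        ((contDiffAt_fst.mul (c eX)).mul (c eZ)))
    (fun x z hz hz' => by
      have dX := hsol.differentiableAt_pd_pot ht hz.le hz'.le eX
      have dZ := hsol.differentiableAt_pd_pot ht hz.le hz'.le eZ
      have xX := hasDerivAt_slice_x dX
      have xZ := hasDerivAt_slice_x dZ
      have zX := hasDerivAt_slice_z dX
      have zZ := hasDerivAt_slice_z dZ
      refine ⟨_, ((xX.mul xZ).const_mul z).add
        (((((hasDerivAt_id' x).mul xX).mul xX).sub
          (((hasDerivAt_id' x).mul xZ).mul xZ)).div_const 2),
        (((hasDerivAt_id' z).mul (((zZ.pow 2).sub (zX.pow 2)).div_const 2)).add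
          ((zX.const_mul x).mul zZ)).congr_deriv ?_⟩
      rw [hsol.pd_comm_pot ht hz.le hz'.le eZ eX]
      simp only [Nat.cast_ofNat, Nat.add_one_sub_one, pow_one, Pi.sub_apply, Pi.mul_apply,
        Pi.pow_apply]
      linear_combination (z * pd eZ (pot φ) (t, x, z) + x * pd eX (pot φ) (t, x, z))
        * hsol.laplace_pd ht hz hz')
    (by
      have oX := (hd.pd_pot eX norm_eX).isBigO
      have oZ := (hd.pd_pot eZ norm_eZ).isBigO
      refine (isBigO_one_mul_weight hd.isBigO_depth (isBigO_mul_weight hα0 oX oZ)).add ?_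
      simp only [div_eq_inv_mul]
      exact ((isBigO_one_mul_weight (isBigO_fst_mul hα.le oX) oX).sub
        (isBigO_one_mul_weight (isBigO_fst_mul hα.le oZ) oZ)).const_mul_left _)
    hsurf
    (by
      simp only [hpb]
      exact (((hd.bot_pd hsol hI ht norm_eX).sq hα0).const_mul (h / 2)).integrable hα)
  simp only [hpb, integral_const_mul] at hflux
  -- This is the derivative of x q η_t along the surface; it absorbs the term with x and the mixed
  -- derivative of η.
  have hd1 := ((hq.mul hα0 hd.speed).add
    ((hu.add (hw.mul hα0 hd.slope)).id_mul_mul hα.le hd.speed)).add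
      (hq.id_mul_mul hα.le hd.slopeRate)
  have hzero1 := (hq.id_mul_mul hα.le hd.speed).integral_eq_zero_of_hasDerivAt hα hd1 fun x => by
    have hb := (hsol.above_bottom t ht x).le
    have d0 := hsol.hasDerivAt_surf_x ht (hsol.differentiableAt_pot ht hb le_rfl)
    refine (((hasDerivAt_id' x).mul d0).mul (hsol.hasDerivAt_surfaceSpeed_x ht x)).congr_deriv ?_
    simp only [Pi.mul_apply]
    ring
  -- This is the derivative of xη²; it absorbs the gravity term gxηη_x left by the dynamic
  -- condition.
  have hd2 := (hd.elev.sq hα0).add ((hd.elev.id_mul_mul hα.le hd.slope).const_mul 2)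
  have hzero2 := (hd.elev.id_mul_mul hα.le hd.elev).integral_eq_zero_of_hasDerivAt hα hd2
    fun x => by
      have d := hsol.hasDerivAt_slope ht x
      refine (((hasDerivAt_id' x).mul d).mul d).congr_deriv ?_
      simp only [Pi.mul_apply]
      ring
  have hham := (((hq.mul hα0 (hw.sub (hu.mul hα0 hd.slope))).add
    ((hd.elev.sq hα0).const_mul g)).div_const 2)
  have hhameq : hamiltonian g η φ t = _ :=
    integral_congr_ae (Eventually.of_forall fun x => hsol.alongSurface_ham ht x)
  have i1 := (hham.const_mul 4).integrable hα
  have i2 := ((hd.elev.sq hα0).const_mul (7 / 2 * g)).integrable hα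
  have i4 := hd1.integrable hα
  have i5 := (hd2.const_mul (g / 2)).integrable hα
  -- The rate is 4 times the energy density, minus (7/2)gη², plus the flux density, minus ∂_x(x q
  -- η_t), plus (g/2)∂_x(xη²). The η² coefficients 2g - (7/2)g + g/2 give the -g of q_t η.
  have hsum := integral_combination i1 i2 hsurf i4 i5
  rw [integral_const_mul, integral_const_mul, integral_const_mul, hzero1,
    hzero2, ← hhameq] at hsum
  rw [mul_zero, sub_zero, add_zero] at hsum
  rw [← hflux]
  refine Eq.trans ?_ hsum
  refine integral_congr_ae (Eventually.of_forall fun x => ?_)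
  have hkin := hsol.kinematic_surf ht x
  have hdyn := hsol.dynamic_surf ht x
  simp only [surf] at hkin hdyn ⊢
  rw [hdyn, hkin]
  ring

end laws

/-! ### The boundary integrands, the pressure on the bottom and the law. -/

section densities

variable {ρ g h t α : ℝ} {I : Set ℝ} {η : ℝ → ℝ → ℝ} {φ : ℝ → ℝ → ℝ → ℝ}

/-- The state of rest contributes nothing on z = 0, and the kinematic condition turns φ_z - φ_x η_x
into η_t inside the Hamiltonian form. -/
theorem IsSolution.surfaceExcess_eq_T7 (hsol : IsSolution g h I η φ) (ht : t ∈ I) (x : ℝ) :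
    surfaceExcess g η φ t x = T7 g η φ t x := by
  simp only [surfaceExcess, alongSurface, lawP, lawQ, hamP, hamQ, T7, T2, slope, dz, dx,
    Pi.zero_apply, deriv_const]
  rw [hsol.kinematic t ht x]
  simp only [slope, dz, dx]
  ring

theorem IsSolution.surfaceExcess_eq (hsol : IsSolution g h I η φ) (ht : t ∈ I) (x : ℝ) :
    surfaceExcess g η φ t x
      = surf η (pot φ) t x * η t x - x * surf η (pot φ) t x * slope η t x
        - 4 * t * alongSurface η t (hamP g φ t) (hamQ φ t) x + 7 / 2 * g * t * η t x ^ 2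
        - 7 / 2 * g * t ^ 2 * surf η (pot φ) t x + -(7 / 6 * g ^ 2 * t ^ 3) * η t x := by
  rw [hsol.surfaceExcess_eq_T7 ht, hsol.alongSurface_ham ht, ← hsol.kinematic_surf ht]
  simp only [T7, T2, surf, pot]
  ring

/-- Subtracting the state of rest removes the terms in z alone, and φ_z = 0 removes the kinetic part
of the Hamiltonian form. -/
theorem IsSolution.bottomExcess_eq (hsol : IsSolution g h I η φ) (ht : t ∈ I) (x : ℝ) :
    bottomExcess g h φ t x = -(h + 7 / 2 * g * t ^ 2) * bot h (pot φ) t x := by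
  simp only [bottomExcess, lawP, hamP, hsol.bottom t ht x, bot, pot, Pi.zero_apply]
  ring

theorem IsSolution.bottomPressureExcess_eq (hsol : IsSolution g h I η φ) (hρ : ρ ≠ 0)
    (ht : t ∈ I) (x : ℝ) :
    bottomPressureExcess ρ g h φ t x
      = -bot h (pd eT (pot φ)) t x - bot h (pd eX (pot φ)) t x ^ 2 / 2 := by
  have ha := (hsol.above_bottom t ht x).le
  have h0 : dt 0 t x (-h) = 0 ∧ dx 0 t x (-h) = 0 ∧ dz 0 t x (-h) = 0 := by simp [dt, dx, dz]
  simp only [bottomPressureExcess, pressure, hsol.bottom t ht x, h0,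
    hsol.dt_eq ht le_rfl ha, hsol.dx_eq ht le_rfl ha, bot]
  field_simp
  ring

theorem SolutionDecay.alongSurface_ham (hd : SolutionDecay h η φ α t)
    (hsol : IsSolution g h I η φ) (hI : IsOpen I) (ht : t ∈ I) :
    Decaying α t fun s x => alongSurface η s (hamP g φ s) (hamQ φ s) x := by
  have hα0 : 0 ≤ α := by linarith [hd.one_lt]
  refine ((((hd.surf_pot hsol hI ht).mul hα0 ((hd.surf_pd hsol hI ht norm_eZ).sub
    ((hd.surf_pd hsol hI ht norm_eX).mul hα0 hd.slope))).add
      ((hd.elev.sq hα0).const_mul g)).div_const 2).congr ?_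
  filter_upwards [hI.mem_nhds ht] with s hs x using hsol.alongSurface_ham hs x

theorem SolutionDecay.integrable_ham (hd : SolutionDecay h η φ α t)
    (hsol : IsSolution g h I η φ) (hI : IsOpen I) (ht : t ∈ I) :
    Integrable fun x => alongSurface η t (hamP g φ t) (hamQ φ t) x :=
  (hd.alongSurface_ham hsol hI ht).integrable hd.one_lt

theorem SolutionDecay.integrable_scaling (hd : SolutionDecay h η φ α t)
    (hsol : IsSolution g h I η φ) (hI : IsOpen I) (ht : t ∈ I) :
    Integrable fun x => surf η (WaterWave.pot φ) t x * η t x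
      - x * surf η (WaterWave.pot φ) t x * WaterWave.slope η t x :=
  (((hd.surf_pot hsol hI ht).mul (by linarith [hd.one_lt]) hd.elev).sub
    ((hd.surf_pot hsol hI ht).id_mul_mul hd.one_lt.le hd.slope)).integrable hd.one_lt

theorem SolutionDecay.integrable_elev_sq (hd : SolutionDecay h η φ α t) :
    Integrable fun x => η t x ^ 2 :=
  (hd.elev.sq (by linarith [hd.one_lt])).integrable hd.one_lt

theorem SolutionDecay.integrable_surfaceExcess (hd : SolutionDecay h η φ α t)
    (hsol : IsSolution g h I η φ) (hI : IsOpen I) (ht : t ∈ I) :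
    Integrable fun x => surfaceExcess g η φ t x := by
  simp only [hsol.surfaceExcess_eq ht]
  exact ((((hd.integrable_scaling hsol hI ht).sub
    ((hd.integrable_ham hsol hI ht).const_mul _)).add (hd.integrable_elev_sq.const_mul _)).sub
      (((hd.surf_pot hsol hI ht).integrable hd.one_lt).const_mul _)).add
        ((hd.elev.integrable hd.one_lt).const_mul _)

theorem SolutionDecay.integrable_bottomExcess (hd : SolutionDecay h η φ α t)
    (hsol : IsSolution g h I η φ) (hI : IsOpen I) (ht : t ∈ I) :
    Integrable fun x => bottomExcess g h φ t x := by
  simp only [hsol.bottomExcess_eq ht]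
  exact ((hsol.decaying_bot hI ht hd.pot).integrable hd.one_lt).const_mul _

theorem SolutionDecay.integrable_bottomPressureExcess (hd : SolutionDecay h η φ α t)
    (hsol : IsSolution g h I η φ) (hI : IsOpen I) (hρ : ρ ≠ 0) (ht : t ∈ I) :
    Integrable fun x => bottomPressureExcess ρ g h φ t x := by
  simp only [hsol.bottomPressureExcess_eq hρ ht]
  exact ((hd.bot_pd hsol hI ht norm_eT).neg.sub
    (((hd.bot_pd hsol hI ht norm_eX).sq (by linarith [hd.one_lt])).div_const 2)).integrable
      hd.one_lt

theorem SolutionDecay.integral_bottomPressureExcess (hd : SolutionDecay h η φ α t)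
    (hsol : IsSolution g h I η φ) (hI : IsOpen I) (hρ : ρ ≠ 0) (ht : t ∈ I) :
    ∫ x, bottomPressureExcess ρ g h φ t x
      = -(∫ x, bot h (pd eT (WaterWave.pot φ)) t x)
        - (∫ x, bot h (pd eX (WaterWave.pot φ)) t x ^ 2) / 2 := by
  simp only [hsol.bottomPressureExcess_eq hρ ht]
  rw [integral_sub ((hd.bot_pd hsol hI ht norm_eT).neg.integrable hd.one_lt)
    ((((hd.bot_pd hsol hI ht norm_eX).sq (by linarith [hd.one_lt])).div_const 2).integrable
      hd.one_lt), integral_neg, integral_div]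

/-- The contour integral in terms of the moments of the wave. -/
theorem SolutionDecay.contourExcess_eq (hd : SolutionDecay h η φ α t)
    (hsol : IsSolution g h I η φ) (hI : IsOpen I) (ht : t ∈ I) :
    contourExcess g h η φ t
      = -(h + 7 / 2 * g * t ^ 2) * (∫ x, bot h (WaterWave.pot φ) t x)
        - ((∫ x, (surf η (WaterWave.pot φ) t x * η t x
            - x * surf η (WaterWave.pot φ) t x * WaterWave.slope η t x))
          - 4 * t * hamiltonian g η φ t + 7 / 2 * g * t * (∫ x, η t x ^ 2)
          - 7 / 2 * g * t ^ 2 * (∫ x, surf η (WaterWave.pot φ) t x)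
          + -(7 / 6 * g ^ 2 * t ^ 3) * ∫ x, η t x) := by
  simp only [contourExcess, hsol.bottomExcess_eq ht, hsol.surfaceExcess_eq ht]
  rw [integral_combination (hd.integrable_scaling hsol hI ht)
    ((hd.integrable_ham hsol hI ht).const_mul _) (hd.integrable_elev_sq.const_mul _)
    (((hd.surf_pot hsol hI ht).integrable hd.one_lt).const_mul _)
    ((hd.elev.integrable hd.one_lt).const_mul _)]
  simp only [integral_const_mul, hamiltonian]

theorem IsSolution.hasDerivAt_integral_bot (hsol : IsSolution g h I η φ) (hI : IsOpen I)
    (ht : t ∈ I) (hd : SolutionDecay h η φ α t) :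
    HasDerivAt (fun s => ∫ x, bot h (pot φ) s x) (∫ x, bot h (pd eT (pot φ)) t x) t :=
  (hsol.decaying_bot hI ht hd.pot).hasDerivAt_integral hd.one_lt
    (hd.bot_pd hsol hI ht norm_eT) <| by
      filter_upwards [hI.mem_nhds ht] with s hs x using hasDerivAt_bot_t
        (hsol.differentiableAt_pot hs le_rfl (hsol.above_bottom s hs x).le)

/-- The conservation law with its bottom flux. -/
theorem IsSolution.hasDerivAt_contourExcess (hsol : IsSolution g h I η φ) (hI : IsOpen I)
    (hρ : ρ ≠ 0) (ht : t ∈ I) :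
    HasDerivAt (contourExcess g h η φ)
      (∫ x, (h + 7 / 2 * g * t ^ 2) * bottomPressureExcess ρ g h φ t x) t := by
  obtain ⟨α, hd⟩ := hsol.exists_decay hI ht
  have hev : contourExcess g h η φ =ᶠ[𝓝 t] fun s =>
      -(h + 7 / 2 * g * s ^ 2) * (∫ x, bot h (pot φ) s x)
        - ((∫ x, (surf η (pot φ) s x * η s x - x * surf η (pot φ) s x * slope η s x))
          - 4 * s * hamiltonian g η φ s + 7 / 2 * g * s * (∫ x, η s x ^ 2)
          - 7 / 2 * g * s ^ 2 * (∫ x, surf η (pot φ) s x)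
          + -(7 / 6 * g ^ 2 * s ^ 3) * ∫ x, η s x) := by
    filter_upwards [hI.mem_nhds ht] with s hs
    -- The decomposition at s needs only integrability at that time, so the exponent may differ from
    -- the one at t.
    obtain ⟨β, hd'⟩ := hsol.exists_decay hI hs
    exact hd'.contourExcess_eq hsol hI hs
  have hid := hasDerivAt_id' t
  have hcube : HasDerivAt (fun s : ℝ => s ^ 3) (3 * t ^ 2) t := by
    simpa using hasDerivAt_pow 3 t
  have hsq : HasDerivAt (fun s : ℝ => s ^ 2) (2 * t) t := by
    simpa using hasDerivAt_pow 2 t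
  refine HasDerivAt.congr_of_eventuallyEq ?_ hev
  have hB := (((hsq.const_mul (7 / 2 * g)).const_add h).fun_neg).fun_mul
    (hsol.hasDerivAt_integral_bot hI ht hd)
  have hE := (hid.const_mul 4).fun_mul (hsol.hasDerivAt_hamiltonian hI ht hd)
  have hV := (hid.const_mul (7 / 2 * g)).fun_mul (hsol.hasDerivAt_integral_elev_sq hI ht hd)
  have hQ := (hsq.const_mul (7 / 2 * g)).fun_mul (hsol.hasDerivAt_impulse hI ht hd)
  have hM := ((hcube.const_mul (7 / 6 * g ^ 2)).fun_neg).fun_mul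
    (hsol.hasDerivAt_mass hI ht hd)
  refine (hB.fun_sub (((((hsol.hasDerivAt_scaling hI ht hd).fun_sub hE).fun_add hV).fun_sub
    hQ).fun_add hM)).congr_deriv ?_
  -- The rates now cancel as a polynomial identity; in particular -7gtB from the bottom coefficient
  -- cancels against the -2B in the rate of ∫η².
  rw [integral_const_mul, hd.integral_bottomPressureExcess hsol hI hρ ht]
  ring

end densities

end WaterWave

end

theorem mainTheorem5 (ρ g h : ℝ) (hρ : 0 < ρ) (hg : 0 < g) (hh : 0 < h)
    (I : Set ℝ) (hI : IsOpen I) (η : ℝ → ℝ → ℝ) (φ : ℝ → ℝ → ℝ → ℝ)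
    (hsol : WaterWave.IsSolution g h I η φ) :
    -- on the surface the one-form of the law is the scaling density
    (∀ t ∈ I, ∀ x, WaterWave.surfaceExcess g η φ t x = WaterWave.T7 g η φ t x) ∧
    -- every integral below converges
    (∀ t ∈ I,
      Integrable (fun x =>
        WaterWave.alongSurface η t (WaterWave.hamP g φ t) (WaterWave.hamQ φ t) x) ∧
      Integrable (fun x => WaterWave.surfaceExcess g η φ t x) ∧
      Integrable (fun x => WaterWave.bottomExcess g h φ t x) ∧
      Integrable (fun x => WaterWave.bottomPressureExcess ρ g h φ t x)) ∧
    -- the Hamiltonian is conserved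
    (∀ t ∈ I, HasDerivAt (WaterWave.hamiltonian g η φ) 0 t) ∧
    -- the conservation law with its bottom flux
    (∀ t ∈ I, HasDerivAt (WaterWave.contourExcess g h η φ)
      (∫ x, (h + 7 / 2 * g * t ^ 2) * WaterWave.bottomPressureExcess ρ g h φ t x) t) := by
  refine ⟨fun t ht x => hsol.surfaceExcess_eq_T7 ht x, fun t ht => ?_, fun t ht => ?_,
    fun t ht => hsol.hasDerivAt_contourExcess hI hρ.ne' ht⟩
  · obtain ⟨α, hd⟩ := hsol.exists_decay hI ht
    exact ⟨hd.integrable_ham hsol hI ht, hd.integrable_surfaceExcess hsol hI ht,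
      hd.integrable_bottomExcess hsol hI ht,
      hd.integrable_bottomPressureExcess hsol hI hρ.ne' ht⟩
  · obtain ⟨α, hd⟩ := hsol.exists_decay hI ht
    exact hsol.hasDerivAt_hamiltonian hI ht hd
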